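/- Let $(\mathcal P,\Omega)$ be a finite-dimensional smooth symplectic manifold without boundary, let $G$ be a (finite-dimensional, real) Lie group with Lie algebra $\mathfrak g$, and let $\Phi\colon G\times\mathcal P\to\mathcal P$ be a smooth symplectic left action, $\Phi_g^*\Omega=\Omega$ for all $g\in G$. For $\xi\in\mathfrak g$ let $\xi_{\mathcal P}(z)=\frac{d}{dt}\big|_{t=0}\Phi_{\exp(t\xi)}(z)$ be its infinitesimal generator. A momentum map of the action is a smooth map $\mathbf J\colon\mathcal P\to\mathfrak g^*$ with $i_{\xi_{\mathcal P}}\Omega=d\langle\mathbf J,\xi\rangle$ for all $\xi\in\mathfrak g$. Let $\tau\colon T\mathcal P\to\mathcal P$ be the tangent bundle, with the canonical one-form $$\Theta_{T\mathcal P}(\delta z)\cdot v=\Omega\big(T\tau(v),\delta z\big),\qquad v\in T_{\delta z}(T\mathcal P),$$ and put $\Omega_{T\mathcal P}=-d\Theta_{T\mathcal P}$. Let $T\Phi$ be the induced action on $T\mathcal P$, in which $g$ acts by the tangent map $T\Phi_g$. Suppose that the smooth function $H\colon\mathcal P\to\mathbb R$ is invariant, $H\circ\Phi_g=H$ for all $g\in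 G$, and that $\mathbf J$ is a momentum map of $\Phi$. For $\delta z\in T_z\mathcal P$ set $\tilde H(\delta z)=dH(z)\cdot\delta z$ and $\tilde{\mathbf J}(\delta z)=d\mathbf J(z)\cdot\delta z\in\mathfrak g^*$. Then: 1. $\Omega_{T\mathcal P}$ is a symplectic form on $T\mathcal P$, and $T\Phi$ is a smooth action that preserves $\Theta_{T\mathcal P}$ and $\Omega_{T\mathcal P}$. 2. $\tilde{\mathbf J}\colon T\mathcal P\to\mathfrak g^*$ is a momentum map of the action $T\Phi$ on $(T\mathcal P,\Omega_{T\mathcal P})$; more precisely, it is the canonical one determined by the invariant one-form, $\langle\tilde{\mathbf J},\xi\rangle=i_{\xi_{T\mathcal P}}\Theta_{T\mathcal P}$ for all $\xi\in\mathfrak g$. 3. $\tilde{\mathbf J}$ is conserved along the flow of the first variation equation: it is constant along every solution curve (defined on any interval) of the Hamiltonian system $i_{X_{\tilde H}}\Omega_{T\mathcal P}=d\tilde H$, and $\tilde{\mathbf J}\circ T\phi_t=\tilde{\mathbf J}$ (where defined) for every smooth local flow $\phi_t$ of the Hamiltonian vector field $X_H$, $i_{X_H}\Omega=dH$. -/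

import Mathlib

open scoped Manifold ContDiff

noncomputable section

namespace SymplecticNoether

section Forms

variable {E : Type*} [NormedAddCommGroup E] [NormedSpace ℝ E]
  {H : Type*} [TopologicalSpace H] (I : ModelWithCorners ℝ E H)
  {M : Type*} [TopologicalSpace M] [ChartedSpace H M]

variable (M) in
/-- A (not necessarily smooth) differential `n`-form on the manifold `M`. -/
abbrev DiffForm (n : ℕ) : Type _ := (x : M) → TangentSpace I x [⋀^Fin n]→L[ℝ] ℝ

variable {I}

/-- The pullback `f^* η` of a form along a map `f : M → M`. -/
def DiffForm.pullback {n : ℕ} (η : DiffForm I M n) (f : M → M) : DiffForm I M n := fun x =>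
  (η (f x)).compContinuousLinearMap (mfderiv I I f x)

/-- The local expression of a form in the preferred chart at `x`, as a form on the model vector
space `E`; only its values on the (open, if `M` has no boundary) target of the chart matter. -/
def DiffForm.inChart {n : ℕ} (η : DiffForm I M n) (x : M) : E → E [⋀^Fin n]→L[ℝ] ℝ := fun y =>
  (η ((extChartAt I x).symm y)).compContinuousLinearMap
    (mfderiv 𝓘(ℝ, E) I (extChartAt I x).symm y)

/-- A form is smooth if all its local expressions are smooth. -/
def DiffForm.IsSmooth {n : ℕ} (η : DiffForm I M n) : Prop :=
  ∀ x : M, ContDiffOn ℝ ∞ (η.inChart x) (extChartAt I x).target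

/-- The exterior derivative of a form: at `x` it is computed in the preferred chart at `x`. -/
def DiffForm.d {n : ℕ} (η : DiffForm I M n) : DiffForm I M (n + 1) := fun x =>
  (extDeriv (η.inChart x) (extChartAt I x x)).compContinuousLinearMap
    (mfderiv I 𝓘(ℝ, E) (extChartAt I x) x)

/-- A symplectic form: a smooth, closed and nondegenerate `2`-form. -/
structure IsSymplecticForm (Ω : DiffForm I M 2) : Prop where
  smooth : Ω.IsSmooth
  closed : ∀ x, Ω.d x = 0
  nondegenerate : ∀ (x : M) (v : TangentSpace I x),
    (∀ w : TangentSpace I x, Ω x ![v, w] = 0) → v = 0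

/-- `X` is the Hamiltonian vector field of `h`: `i_X Ω = dh`. -/
def IsHamiltonianVectorField (Ω : DiffForm I M 2) (h : M → ℝ)
    (X : (x : M) → TangentSpace I x) : Prop :=
  ∀ (x : M) (v : TangentSpace I x), Ω x ![X x, v] = mfderiv I 𝓘(ℝ, ℝ) h x v

/-- `φ` is a smooth local flow of the vector field `X`, defined for initial points in the open set
`U` and times in the open interval `s` around `0`. -/
structure IsLocalFlow (X : (x : M) → TangentSpace I x) (U : Set M) (s : Set ℝ)
    (φ : ℝ → M → M) : Prop where
  isOpen_space : IsOpen U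
  isOpen_time : IsOpen s
  ordConnected_time : s.OrdConnected
  zero_mem : (0 : ℝ) ∈ s
  smooth : ContMDiffOn (𝓘(ℝ, ℝ).prod I) I ∞ (fun p : ℝ × M => φ p.1 p.2) (s ×ˢ U)
  map_zero : ∀ z ∈ U, φ 0 z = z
  integralCurve : ∀ z ∈ U, IsMIntegralCurveOn (I := I) (fun t => φ t z) X s

/-- For `f : M → F`, the function `δz ↦ df(z) · δz` on the tangent bundle, `z` being the base point
of `δz`. -/
def tangentLift {F : Type*} [NormedAddCommGroup F] [NormedSpace ℝ F] (f : M → F)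
    (δz : TangentBundle I M) : F :=
  mfderiv I 𝓘(ℝ, F) f δz.proj δz.2

/-- The canonical one-form on the tangent bundle of a symplectic manifold:
`Θ(δz) · v = Ω(Tτ(v), δz)`, where `τ : TM → M` is the projection. -/
def tangentOneForm [IsManifold I ∞ M] (Ω : DiffForm I M 2) :
    DiffForm I.tangent (TangentBundle I M) 1 := fun δz =>
  ContinuousAlternatingMap.ofSubsingleton ℝ (TangentSpace I.tangent δz) ℝ (0 : Fin 1)
    (((Ω δz.proj).toContinuousLinearMap ![0, δz.2] 0).comp
      (mfderiv I.tangent I (Bundle.TotalSpace.proj : TangentBundle I M → M) δz))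

theorem tangentOneForm_apply [IsManifold I ∞ M] (Ω : DiffForm I M 2) (δz : TangentBundle I M)
    (v : TangentSpace I.tangent δz) :
    tangentOneForm Ω δz ![v] =
      Ω δz.proj ![mfderiv I.tangent I (Bundle.TotalSpace.proj : TangentBundle I M → M) δz v,
        δz.2] := by
  have hu : ∀ a b c : TangentSpace I δz.proj, Function.update ![a, b] 0 c = ![c, b] := by
    intro a b c
    ext i
    fin_cases i <;> rfl
  simp [tangentOneForm, hu]

/-- The canonical symplectic form `-dΘ` on the tangent bundle of a symplectic manifold. -/
def tangentSymplecticForm [IsManifold I ∞ M] (Ω : DiffForm I M 2) :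
    DiffForm I.tangent (TangentBundle I M) 2 := fun δz => -(tangentOneForm Ω).d δz

end Forms

section Actions

variable {E : Type*} [NormedAddCommGroup E] [NormedSpace ℝ E]
  {H : Type*} [TopologicalSpace H] {I : ModelWithCorners ℝ E H}
  {M : Type*} [TopologicalSpace M] [ChartedSpace H M]
  {EG : Type*} [NormedAddCommGroup EG] [NormedSpace ℝ EG]
  {HG : Type*} [TopologicalSpace HG] {IG : ModelWithCorners ℝ EG HG}
  {G : Type*} [TopologicalSpace G] [ChartedSpace HG G] [Group G]

/-- The exponential map of a Lie group: `exp ξ = γ 1`, where `γ` is the integral curve of the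
left-invariant vector field of `ξ` with `γ 0 = 1`. -/
def lieExp (ξ : GroupLieAlgebra IG G) : G :=
  (Classical.epsilon fun γ : ℝ → G =>
    γ 0 = 1 ∧ IsMIntegralCurve (I := IG) γ (mulInvariantVectorField ξ)) 1

variable (IG I) in
/-- `Φ` is a smooth (left) action of the Lie group `G` on the manifold `M`. -/
structure IsSmoothAction (Φ : G → M → M) : Prop where
  one : ∀ x, Φ 1 x = x
  mul : ∀ g h x, Φ (g * h) x = Φ g (Φ h x)
  smooth : ContMDiff (IG.prod I) I ∞ (fun p : G × M => Φ p.1 p.2)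

variable (IG) in
/-- `Φ` is a smooth action that preserves the form `Ω`. -/
structure IsSymplecticAction (Ω : DiffForm I M 2) (Φ : G → M → M) : Prop
    extends IsSmoothAction I IG Φ where
  symplectic : ∀ (g : G) (x : M), Ω.pullback (Φ g) x = Ω x

variable (I) in
/-- The infinitesimal generator `ξ_M(x) = d/dt|_{t=0} Φ_{exp(tξ)}(x)` of an action. (The curve
passes through `x` at `t = 0`, as `exp 0 = 1`.) -/
def infinitesimalGenerator (Φ : G → M → M) (ξ : GroupLieAlgebra IG G) (x : M) :
    TangentSpace I x :=
  mfderiv 𝓘(ℝ, ℝ) I (fun t : ℝ => Φ (lieExp (t • ξ)) x) 0 (1 : ℝ)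

/-- The dual `𝔤^*` of the Lie algebra `𝔤 = T_1 G`, as a normed space: `T_1 G` is by definition the
model vector space of `G`. -/
abbrev LieDual (_IG : ModelWithCorners ℝ EG HG) (_G : Type*) : Type _ := EG →L[ℝ] ℝ

/-- `J : M → 𝔤^*` is a momentum map of the action `Φ` on `(M, Ω)`: it is smooth and
`i_{ξ_M} Ω = d⟨J, ξ⟩` for all `ξ ∈ 𝔤`. -/
structure IsMomentumMap (Ω : DiffForm I M 2) (Φ : G → M → M) (J : M → LieDual IG G) : Prop where
  smooth : ContMDiff I 𝓘(ℝ, LieDual IG G) ∞ J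
  hamiltonian : ∀ ξ : GroupLieAlgebra IG G,
    IsHamiltonianVectorField Ω (fun x => J x ξ) (infinitesimalGenerator I Φ ξ)

variable (I) in
/-- The induced action `TΦ` on the tangent bundle: `g` acts by the tangent map of `Φ g`. -/
def tangentAction (Φ : G → M → M) : G → TangentBundle I M → TangentBundle I M :=
  fun g => tangentMap I I (Φ g)

end Actions

end SymplecticNoether


end

open SymplecticNoether

/-!
The statement is local, and it is proved by computing in the charts of the tangent bundle, which
are the tangent maps of the charts of the manifold. In the chart `(a, b)` the canonical one-form is
`Θ = Ω_a(da, b)`, and, because `Ω` is closed, `-dΘ` at a tangent vector `w` is the tangent lift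
`Ω(u.1, v.2) + Ω(u.2, v.1) + (D_w Ω)(u.1, v.1)` of `Ω` (`tangentSymplecticForm_apply`). This form is
visibly nondegenerate. That it is smooth, closed and invariant under tangent maps of symplectic maps
follows from the same properties of `Θ` by naturality of the exterior derivative
(`DiffForm.d_pullback`, `DiffForm.d_inChart`).

For the momentum map, the main point is that lifting preserves Hamiltonian vector fields: if
`i_X Ω = df`, then differentiating this identity in a chart along `w` shows that the complete lift
`(X, DX w)` is the Hamiltonian vector field of the lift of `f` (`tangentSymplecticForm_lift`). The
generators of the tangent action are the complete lifts of the generators of the action, by the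
symmetry of second derivatives (`infinitesimalGenerator_tangentAction`), so the lift of `J` is a
momentum map. For this one has to know that `t ↦ exp (t ξ)` has derivative `ξ` at `0`, i.e. that
left-invariant vector fields are complete and that their integral curves are unique
(`exists_lieExp_smul_eq`).

Conservation is Noether's theorem (`IsMomentumMap.eq_on_integralCurve`), applied on the tangent
bundle for the solutions of the lifted Hamiltonian system, and on the manifold itself for the
linearized flow: there `J ∘ φ t = J` on an open set, and this identity is differentiated.
-/

namespace SymplecticNoether

open Filter Set Bundle
open scoped Topology

/-! ### Forms of low degree on a normed space -/

section NormedSpaceForms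

theorem minSmoothness_two_le_infty : minSmoothness ℝ 2 ≤ (∞ : ℕ∞ω) := by
  rw [minSmoothness_of_isRCLikeNormedField]
  exact WithTop.coe_le_coe.2 (le_top : (2 : ℕ∞) ≤ ⊤)

theorem ContinuousAlternatingMap.map_two_swap {V : Type*} [NormedAddCommGroup V] [NormedSpace ℝ V]
    (α : V [⋀^Fin 2]→L[ℝ] ℝ) (u v : V) : α ![u, v] = -α ![v, u] := by
  have h : α (![v, u] ∘ Equiv.swap (0 : Fin 2) 1) = -α ![v, u] :=
    α.map_swap ![v, u] (i := 0) (j := 1) (by simp)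
  have h1 : ![v, u] ∘ Equiv.swap (0 : Fin 2) 1 = ![u, v] := by
    funext i
    fin_cases i <;> rfl
  rw [← h, h1]

theorem extDeriv_one_form_apply {V : Type*} [NormedAddCommGroup V] [NormedSpace ℝ V]
    {α : V → V [⋀^Fin 1]→L[ℝ] ℝ} {x : V} (hα : DifferentiableAt ℝ α x) (u v : V) :
    extDeriv α x ![u, v] = fderiv ℝ (fun y => α y ![v]) x u - fderiv ℝ (fun y => α y ![u]) x v := by
  rw [extDeriv_apply hα, Fin.sum_univ_two]
  have h0 : (0 : Fin 2).removeNth ![u, v] = ![v] := by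
    funext i
    fin_cases i; rfl
  have h1 : (1 : Fin 2).removeNth ![u, v] = ![u] := by
    funext i
    fin_cases i; rfl
  rw [h0, h1]
  simp [sub_eq_add_neg]

theorem extDeriv_two_form_apply {V : Type*} [NormedAddCommGroup V] [NormedSpace ℝ V]
    {α : V → V [⋀^Fin 2]→L[ℝ] ℝ} {x : V} (u v w : V) :
    extDeriv α x ![u, v, w] =
      fderiv ℝ α x u ![v, w] - fderiv ℝ α x v ![u, w] + fderiv ℝ α x w ![u, v] := by
  rw [extDeriv, ContinuousAlternatingMap.alternatizeUncurryFin_apply, Fin.sum_univ_three]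
  have h0 : (0 : Fin 3).removeNth ![u, v, w] = ![v, w] := by
    funext i
    fin_cases i <;> rfl
  have h1 : (1 : Fin 3).removeNth ![u, v, w] = ![u, w] := by
    funext i
    fin_cases i <;> rfl
  have h2 : (2 : Fin 3).removeNth ![u, v, w] = ![u, v] := by
    funext i
    fin_cases i <;> rfl
  rw [h0, h1, h2]
  simp [sub_eq_add_neg]

/-- The product rule for the evaluation of a varying two-form on two varying vectors. -/
theorem hasFDerivAt_two_form_apply {V W : Type*} [NormedAddCommGroup V] [NormedSpace ℝ V]
    [NormedAddCommGroup W] [NormedSpace ℝ W]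
    {α : W → V [⋀^Fin 2]→L[ℝ] ℝ} {f g : W → V} {x : W} {α' : W →L[ℝ] V [⋀^Fin 2]→L[ℝ] ℝ}
    {f' g' : W →L[ℝ] V} (hα : HasFDerivAt α α' x)
    (hf : HasFDerivAt f f' x) (hg : HasFDerivAt g g' x) :
    ∃ L : W →L[ℝ] ℝ, HasFDerivAt (fun y => α y ![f y, g y]) L x ∧
      ∀ v, L v = α' v ![f x, g x] + α x ![f' v, g x] + α x ![f x, g' v] := by
  have hfg : ∀ i, HasFDerivAt (fun y => ![f y, g y] i) (![f', g'] i) x := by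
    intro i
    fin_cases i
    · exact hf
    · exact hg
  refine ⟨_, hα.continuousAlternatingMap_apply hfg, fun v => ?_⟩
  have h1 : ∀ a b c : V, Function.update ![a, b] 0 c = ![c, b] := by
    intro a b c
    funext i
    fin_cases i <;> rfl
  have h2 : ∀ a b c : V, Function.update ![a, b] 1 c = ![a, c] := by
    intro a b c
    funext i
    fin_cases i <;> rfl
  simp [h1, h2, add_assoc]

theorem contDiffAt_extDeriv {V : Type*} [NormedAddCommGroup V] [NormedSpace ℝ V] {n : ℕ}
    {α : V → V [⋀^Fin n]→L[ℝ] ℝ} {x : V}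
    (hα : ContDiffAt ℝ ∞ α x) : ContDiffAt ℝ ∞ (extDeriv α) x := by
  have h : extDeriv α =
      ContinuousAlternatingMap.alternatizeUncurryFinCLM ℝ V ℝ ∘ fderiv ℝ α := rfl
  rw [h]
  exact (ContinuousAlternatingMap.alternatizeUncurryFinCLM ℝ V ℝ).contDiff.contDiffAt.comp x
    (hα.fderiv_right (m := ∞) (by simp))

end NormedSpaceForms

/-! ### Naturality of the exterior derivative on manifolds -/

section FormCalculus

variable {E : Type*} [NormedAddCommGroup E] [NormedSpace ℝ E]
  {H : Type*} [TopologicalSpace H] {I : ModelWithCorners ℝ E H}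
  {M : Type*} [TopologicalSpace M] [ChartedSpace H M]

/-- Rewriting of the base point of `η p`, together with a linear map into the tangent space at `p`.
All tangent spaces of `M` are the same type `E`, so the statement makes sense although `p` and `q`
are only propositionally equal. -/
theorem DiffForm.compContinuousLinearMap_congr {n : ℕ} (η : DiffForm I M n) {p q : M} (hpq : p = q)
    {V : Type*} [NormedAddCommGroup V] [NormedSpace ℝ V] {L L' : V →L[ℝ] E} (hL : L = L') :
    (ContinuousAlternatingMap.compContinuousLinearMap (η p : E [⋀^Fin n]→L[ℝ] ℝ) L) =
      (ContinuousAlternatingMap.compContinuousLinearMap (η q : E [⋀^Fin n]→L[ℝ] ℝ) L') := by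
  subst hpq hL; rfl

theorem DiffForm.pullback_id {n : ℕ} (η : DiffForm I M n) : η.pullback id = η := by
  funext x
  have := η.compContinuousLinearMap_congr (V := E) (p := x) rfl (mfderiv_id (I := I) (x := x))
  exact this

/-- Without boundary, the manifold derivative at `x` is the derivative of the local expression in
the preferred charts at `x` and `f x`. -/
theorem mfderiv_eq_fderiv_writtenInExtChartAt
    [I.Boundaryless] {E' : Type*} [NormedAddCommGroup E'] [NormedSpace ℝ E']
    {H' : Type*} [TopologicalSpace H'] {I' : ModelWithCorners ℝ E' H'}
    {M' : Type*} [TopologicalSpace M'] [ChartedSpace H' M'] {f : M → M'} {x : M}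
    (hf : MDifferentiableAt I I' f x) :
    mfderiv I I' f x = (fderiv ℝ (extChartAt I' (f x) ∘ f ∘ (extChartAt I x).symm)
      (extChartAt I x x) : E →L[ℝ] E') := by
  rw [hf.mfderiv, I.range_eq_univ, fderivWithin_univ]
  rfl

theorem DiffForm.IsSmooth.differentiableAt [I.Boundaryless] {n : ℕ} {η : DiffForm I M n}
    (hη : η.IsSmooth) {x : M} {y : E} (hy : y ∈ (extChartAt I x).target) :
    DifferentiableAt ℝ (η.inChart x) y :=
  ((hη x).contDiffAt (extChartAt_target_mem_nhds' hy)).differentiableAt (by simp)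

theorem DiffForm.d_eq [IsManifold I ∞ M] {n : ℕ} (η : DiffForm I M n) (x : M) :
    η.d x = (extDeriv (η.inChart x) (extChartAt I x x) : E [⋀^Fin (n+1)]→L[ℝ] ℝ) := by
  have : mfderiv I 𝓘(ℝ, E) (extChartAt I x) x = ContinuousLinearMap.id ℝ E :=
    mfderiv_extChartAt_self
  unfold DiffForm.d
  rw [this]
  rfl

variable [I.Boundaryless] [IsManifold I ∞ M]

theorem contMDiffAt_extChartAt_symm {x : M} {y : E} (hy : y ∈ (extChartAt I x).target) :
    ContMDiffAt 𝓘(ℝ, E) I ∞ (extChartAt I x).symm y :=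
  (contMDiffOn_extChartAt_symm x).contMDiffAt ((isOpen_extChartAt_target x).mem_nhds hy)

theorem mdifferentiableAt_extChartAt_symm {x : M} {y : E} (hy : y ∈ (extChartAt I x).target) :
    MDifferentiableAt 𝓘(ℝ, E) I (extChartAt I x).symm y :=
  (contMDiffAt_extChartAt_symm hy).mdifferentiableAt (by simp)

/-- The local expression of `f^* η` is the pullback of a local expression of `η` under the local
expression of `f`, in any pair of charts. For `f = id` this is the change of charts. -/
theorem DiffForm.pullback_inChart {n : ℕ} (η : DiffForm I M n) {f : M → M}
    (hf : ContMDiff I I ∞ f) {x x' : M} {y : E} (hy : y ∈ (extChartAt I x).target)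
    (hy' : f ((extChartAt I x).symm y) ∈ (extChartAt I x').source) :
    (η.pullback f).inChart x y =
      (η.inChart x' ((extChartAt I x' ∘ f ∘ (extChartAt I x).symm) y)).compContinuousLinearMap
        (fderiv ℝ (extChartAt I x' ∘ f ∘ (extChartAt I x).symm) y) := by
  have hs := mdifferentiableAt_extChartAt_symm hy
  have hfs : MDifferentiableAt 𝓘(ℝ, E) I (f ∘ (extChartAt I x).symm) y :=
    (hf.mdifferentiable (by simp) _).comp y hs
  have hF : MDifferentiableAt 𝓘(ℝ, E) 𝓘(ℝ, E) (extChartAt I x' ∘ f ∘ (extChartAt I x).symm) y :=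
    (mdifferentiableAt_extChartAt (by simpa using hy')).comp y hfs
  have hT : (extChartAt I x') (f ((extChartAt I x).symm y)) ∈ (extChartAt I x').target :=
    (extChartAt I x').map_source hy'
  have hs' := mdifferentiableAt_extChartAt_symm hT
  have h1 := mfderiv_comp y (hf.mdifferentiable (by simp) ((extChartAt I x).symm y)) hs
  have h2 := mfderiv_comp y (g := (extChartAt I x').symm)
    (f := extChartAt I x' ∘ f ∘ (extChartAt I x).symm) hs' hF
  have h3 : (extChartAt I x').symm ∘ (extChartAt I x' ∘ f ∘ (extChartAt I x).symm) =ᶠ[𝓝 y]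
      f ∘ (extChartAt I x).symm := by
    have := hfs.continuousAt.preimage_mem_nhds (extChartAt_source_mem_nhds' (I := I) hy')
    filter_upwards [this] with u hu
    exact (extChartAt I x').left_inv hu
  have h4 := h3.mfderiv_eq (I := 𝓘(ℝ, E)) (I' := I)
  rw [h1] at h4
  rw [h2] at h4
  rw [mfderiv_eq_fderiv] at h4
  have key := η.compContinuousLinearMap_congr (V := E) (h3.self_of_nhds) h4
  exact key.symm

theorem mfderiv_extChartAt_symm_self (x : M) :
    mfderiv 𝓘(ℝ, E) I (extChartAt I x).symm (extChartAt I x x) = ContinuousLinearMap.id ℝ E := by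
  rw [← mfderivWithin_univ, ← I.range_eq_univ]
  exact mfderivWithin_range_extChartAt_symm

theorem DiffForm.inChart_self {n : ℕ} (η : DiffForm I M n) (x : M) :
    η.inChart x (extChartAt I x x) = (η x : E [⋀^Fin n]→L[ℝ] ℝ) :=
  η.compContinuousLinearMap_congr (V := E) (extChartAt_to_inv (I := I) x)
    (mfderiv_extChartAt_symm_self x)

theorem contDiffAt_writtenInChart {f : M → M}
    (hf : ContMDiff I I ∞ f) {x x' : M} {y : E} (hy : y ∈ (extChartAt I x).target)
    (hy' : f ((extChartAt I x).symm y) ∈ (extChartAt I x').source) :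
    ContDiffAt ℝ ∞ (extChartAt I x' ∘ f ∘ (extChartAt I x).symm) y := by
  rw [← contMDiffAt_iff_contDiffAt]
  exact (contMDiffAt_extChartAt' (by simpa using hy')).comp y
    (hf.contMDiffAt.comp y (contMDiffAt_extChartAt_symm hy))

theorem DiffForm.IsSmooth.extDeriv_pullback_inChart {n : ℕ} {η : DiffForm I M n} (hη : η.IsSmooth)
    {f : M → M} (hf : ContMDiff I I ∞ f) {x x' : M} {y : E} (hy : y ∈ (extChartAt I x).target)
    (hy' : f ((extChartAt I x).symm y) ∈ (extChartAt I x').source) :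
    extDeriv ((η.pullback f).inChart x) y =
      (extDeriv (η.inChart x') (extChartAt I x' (f ((extChartAt I x).symm y)))
        ).compContinuousLinearMap (fderiv ℝ (extChartAt I x' ∘ f ∘ (extChartAt I x).symm) y) := by
  have hcont : ContinuousAt (f ∘ (extChartAt I x).symm) y :=
    hf.continuous.continuousAt.comp (mdifferentiableAt_extChartAt_symm hy).continuousAt
  have hev : (η.pullback f).inChart x =ᶠ[𝓝 y] fun u =>
      (η.inChart x' ((extChartAt I x' ∘ f ∘ (extChartAt I x).symm) u)).compContinuousLinearMap
        (fderiv ℝ (extChartAt I x' ∘ f ∘ (extChartAt I x).symm) u) := by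
    filter_upwards [extChartAt_target_mem_nhds' hy,
      hcont.preimage_mem_nhds (extChartAt_source_mem_nhds' (I := I) hy')] with u hu hu'
    exact η.pullback_inChart hf hu hu'
  rw [hev.extDeriv_eq]
  exact extDeriv_pullback (r := ∞) (hη.differentiableAt ((extChartAt I x').map_source hy'))
    (contDiffAt_writtenInChart hf hy hy') minSmoothness_two_le_infty

/-- Naturality of the exterior derivative: `d (f^* η) = f^* (d η)`. -/
theorem DiffForm.d_pullback {n : ℕ} {η : DiffForm I M n} (hη : η.IsSmooth)
    {f : M → M} (hf : ContMDiff I I ∞ f) : (η.pullback f).d = η.d.pullback f := by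
  funext x
  rw [DiffForm.d_eq,
    hη.extDeriv_pullback_inChart hf (x' := f x) (mem_extChartAt_target x) (by simp)]
  unfold DiffForm.pullback
  rw [DiffForm.d_eq, mfderiv_eq_fderiv_writtenInExtChartAt (hf.mdifferentiable (by simp) x)]
  rw [extChartAt_to_inv]
  rfl

/-- The exterior derivative, defined at each point in the preferred chart of that point, may be
computed in any chart. -/
theorem DiffForm.d_inChart {n : ℕ} {η : DiffForm I M n} (hη : η.IsSmooth) {x : M} {y : E}
    (hy : y ∈ (extChartAt I x).target) : η.d.inChart x y = extDeriv (η.inChart x) y := by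
  have h := hη.extDeriv_pullback_inChart (f := id) contMDiff_id (x := x)
    (x' := (extChartAt I x).symm y) hy (by simp)
  rw [DiffForm.pullback_id] at h
  rw [h]
  unfold DiffForm.inChart
  rw [DiffForm.d_eq, mfderiv_eq_fderiv_writtenInExtChartAt (mdifferentiableAt_extChartAt_symm hy)]
  rfl

end FormCalculus

/-! ### Charts of the tangent bundle -/

section TangentChart

variable {E : Type*} [NormedAddCommGroup E] [NormedSpace ℝ E]
  {H : Type*} [TopologicalSpace H] {I : ModelWithCorners ℝ E H}
  {M : Type*} [TopologicalSpace M] [ChartedSpace H M] [IsManifold I ∞ M]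

theorem mem_extChartAt_tangent_target {δz : TangentBundle I M} {p : E × E} :
    p ∈ (extChartAt I.tangent δz).target ↔ p.1 ∈ (extChartAt I δz.proj).target := by
  rw [FiberBundle.extChartAt_target, mem_prod, mem_inter_iff]
  refine ⟨fun h => h.1.1, fun h => ⟨⟨h, ?_⟩, mem_univ _⟩⟩
  simpa using (extChartAt I δz.proj).map_target h

theorem mem_extChartAt_tangent_source {δz q : TangentBundle I M} :
    q ∈ (extChartAt I.tangent δz).source ↔ q.proj ∈ (extChartAt I δz.proj).source := by
  rw [extChartAt_source, extChartAt_source]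
  exact TangentBundle.mem_chart_source_iff q δz

/-- The charts of the tangent bundle are the tangent maps of the charts of the manifold. -/
theorem extChartAt_tangent_apply {δz q : TangentBundle I M}
    (hq : q.proj ∈ (extChartAt I δz.proj).source) :
    extChartAt I.tangent δz q = (extChartAt I δz.proj q.proj,
      (mfderiv I 𝓘(ℝ, E) (extChartAt I δz.proj) q.proj q.2 : E)) := by
  rw [← TangentBundle.continuousLinearMapAt_trivializationAt (by simpa using hq)]
  rw [FiberBundle.extChartAt]
  refine Prod.ext rfl ?_
  change (trivializationAt E (TangentSpace I) δz.proj q).2 = _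
  have hb : q.proj ∈ (trivializationAt E (TangentSpace I) δz.proj).baseSet := by simpa using hq
  exact (congr_fun (Trivialization.coe_linearMapAt_of_mem
    (R := ℝ) (trivializationAt E (TangentSpace I) δz.proj) hb).symm q.2 :)

/-- At the centre of a chart, the local representative of a vector field is its value, as the
tangent space at `x` is identified with `E` by the preferred chart at `x`. -/
theorem mfderiv_extChartAt_vectorField_self (X : (x : M) → TangentSpace I x) (x : M) :
    (mfderiv I 𝓘(ℝ, E) (extChartAt I x) ((extChartAt I x).symm (extChartAt I x x))
      (X ((extChartAt I x).symm (extChartAt I x x))) : E) = X x := by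
  have h : ∀ p q : M, p = q → (mfderiv I 𝓘(ℝ, E) (extChartAt I x) p (X p) : E) =
      mfderiv I 𝓘(ℝ, E) (extChartAt I x) q (X q) := by
    rintro p _ rfl
    rfl
  refine (h _ _ (extChartAt_to_inv (I := I) x)).trans ?_
  rw [mfderiv_extChartAt_self]
  rfl

theorem extChartAt_tangent_self (δz : TangentBundle I M) :
    extChartAt I.tangent δz δz = (extChartAt I δz.proj δz.proj, (δz.2 : E)) := by
  rw [extChartAt_tangent_apply (by simp), mfderiv_extChartAt_self]
  rfl

theorem mfderiv_extChartAt_mfderiv_symm [I.Boundaryless] {x : M} {y : E}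
    (hy : y ∈ (extChartAt I x).target) (v : E) :
    mfderiv I 𝓘(ℝ, E) (extChartAt I x) ((extChartAt I x).symm y)
      (mfderiv 𝓘(ℝ, E) I (extChartAt I x).symm y v) = v := by
  have h := mfderiv_extChartAt_comp_mfderivWithin_extChartAt_symm (I := I) hy
  rw [I.range_eq_univ, mfderivWithin_univ] at h
  exact DFunLike.congr_fun h v

theorem mfderiv_symm_mfderiv_extChartAt [I.Boundaryless] {x : M} {y : E}
    (hy : y ∈ (extChartAt I x).target) (v : E) :
    mfderiv 𝓘(ℝ, E) I (extChartAt I x).symm y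
      (mfderiv I 𝓘(ℝ, E) (extChartAt I x) ((extChartAt I x).symm y) v) = v := by
  have h := mfderivWithin_extChartAt_symm_comp_mfderiv_extChartAt (I := I) hy
  rw [I.range_eq_univ, mfderivWithin_univ] at h
  exact DFunLike.congr_fun h v

theorem extChartAt_tangent_symm_apply [I.Boundaryless] {δz : TangentBundle I M} {a : E} (b : E)
    (ha : a ∈ (extChartAt I δz.proj).target) :
    (extChartAt I.tangent δz).symm (a, b) = ⟨(extChartAt I δz.proj).symm a,
      mfderiv 𝓘(ℝ, E) I (extChartAt I δz.proj).symm a b⟩ := by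
  set q : TangentBundle I M := ⟨(extChartAt I δz.proj).symm a,
      mfderiv 𝓘(ℝ, E) I (extChartAt I δz.proj).symm a b⟩ with hq
  have hq' : q.proj ∈ (extChartAt I δz.proj).source := (extChartAt I δz.proj).map_target ha
  have hab : extChartAt I.tangent δz q = (a, b) := by
    rw [extChartAt_tangent_apply hq']
    refine Prod.ext ((extChartAt I δz.proj).right_inv ha) ?_
    exact mfderiv_extChartAt_mfderiv_symm ha b
  rw [← hab]
  exact (extChartAt I.tangent δz).left_inv (mem_extChartAt_tangent_source.2 hq')

theorem mdifferentiableAt_tangentBundle_proj (δz : TangentBundle I M) :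
    MDifferentiableAt I.tangent I (TotalSpace.proj : TangentBundle I M → M) δz :=
  (contMDiff_proj (TangentSpace I)).mdifferentiable (n := 1) one_ne_zero δz

end TangentChart

/-! ### The canonical forms on the tangent bundle in charts -/

section TangentForms

variable {E : Type*} [NormedAddCommGroup E] [NormedSpace ℝ E]
  {H : Type*} [TopologicalSpace H] {I : ModelWithCorners ℝ E H} [I.Boundaryless]
  {M : Type*} [TopologicalSpace M] [ChartedSpace H M] [IsManifold I ∞ M]

/-- In the chart `(a, b)` of the tangent bundle the canonical one-form is `Ω_a(da, b)`. -/
theorem tangentOneForm_inChart (Ω : DiffForm I M 2) {δz : TangentBundle I M} {p : E × E}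
    (hp : p.1 ∈ (extChartAt I δz.proj).target) (v : E × E) :
    (tangentOneForm Ω).inChart δz p ![v] = Ω.inChart δz.proj p.1 ![v.1, p.2] := by
  have hp' := mem_extChartAt_tangent_target.2 hp
  have hq := extChartAt_tangent_symm_apply p.2 hp
  have hcomp := mfderiv_comp p (mdifferentiableAt_tangentBundle_proj _)
    (mdifferentiableAt_extChartAt_symm hp')
  have hev : (TotalSpace.proj : TangentBundle I M → M) ∘ (extChartAt I.tangent δz).symm =ᶠ[𝓝 p]
      (extChartAt I δz.proj).symm ∘ Prod.fst := by
    filter_upwards [extChartAt_target_mem_nhds' hp'] with u hu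
    have := extChartAt_tangent_symm_apply u.2 (mem_extChartAt_tangent_target.1 hu)
    exact congrArg TotalSpace.proj this
  have hmf := hev.mfderiv_eq (I := 𝓘(ℝ, E × E)) (I' := I)
  have hfst : mfderiv 𝓘(ℝ, E × E) 𝓘(ℝ, E) (Prod.fst : E × E → E) p =
      ContinuousLinearMap.fst ℝ E E := by
    rw [mfderiv_eq_fderiv, fderiv_fst]
  have hcomp' := mfderiv_comp p (mdifferentiableAt_extChartAt_symm hp)
    (mdifferentiableAt_iff_differentiableAt.2 (differentiableAt_fst (𝕜 := ℝ) (p := p)))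
  rw [hcomp'] at hmf
  rw [hcomp] at hmf
  rw [hfst] at hmf
  have hv := DFunLike.congr_fun hmf v
  have hcongr : ∀ (q q' : TangentBundle I M) (_ : q = q') (u u' : E) (_ : u = u'),
      (Ω q.proj : E [⋀^Fin 2]→L[ℝ] ℝ) ![u, q.2] = (Ω q'.proj : E [⋀^Fin 2]→L[ℝ] ℝ) ![u', q'.2] := by
    rintro q _ rfl u _ rfl
    rfl
  have key := hcongr _ _ hq _ _ hv
  have hvec : (fun i => mfderiv 𝓘(ℝ, E) I (extChartAt I δz.proj).symm p.1 (![v.1, p.2] i)) =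
      ![mfderiv 𝓘(ℝ, E) I (extChartAt I δz.proj).symm p.1 v.1,
        mfderiv 𝓘(ℝ, E) I (extChartAt I δz.proj).symm p.1 p.2] := by
    funext i
    fin_cases i <;> rfl
  have hvec' : (fun i => mfderiv 𝓘(ℝ, E × E) I.tangent (extChartAt I.tangent δz).symm p (![v] i)) =
      ![mfderiv 𝓘(ℝ, E × E) I.tangent (extChartAt I.tangent δz).symm p v] := by
    funext i
    fin_cases i; rfl
  change tangentOneForm Ω _
    (fun i => mfderiv 𝓘(ℝ, E × E) I.tangent (extChartAt I.tangent δz).symm p (![v] i)) =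
    Ω _ (fun i => mfderiv 𝓘(ℝ, E) I (extChartAt I δz.proj).symm p.1 (![v.1, p.2] i))
  rw [hvec, hvec', tangentOneForm_apply]
  exact key

/-- The one-form `v ↦ α_a(v.1, b)` at `(a, b)` on `E × E` obtained from a two-form `α` on `E`. It is
written as `-α_a(b, ·)`, pulled back along the first projection, because currying fixes the first
argument. -/
noncomputable def tangentOneFormLocal (α : E → E [⋀^Fin 2]→L[ℝ] ℝ) (p : E × E) :
    (E × E) [⋀^Fin 1]→L[ℝ] ℝ :=
  -((α p.1).curryLeft p.2).compContinuousLinearMap (ContinuousLinearMap.fst ℝ E E)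

theorem tangentOneFormLocal_apply (α : E → E [⋀^Fin 2]→L[ℝ] ℝ) (p v : E × E) :
    tangentOneFormLocal α p ![v] = α p.1 ![v.1, p.2] := by
  rw [ContinuousAlternatingMap.map_two_swap (α p.1)]
  simp only [tangentOneFormLocal, ContinuousAlternatingMap.neg_apply,
    ContinuousAlternatingMap.compContinuousLinearMap_apply,
    ContinuousAlternatingMap.curryLeft_apply_apply]
  congr 2
  funext i
  fin_cases i <;> rfl

theorem ContDiffAt.tangentOneFormLocal {α : E → E [⋀^Fin 2]→L[ℝ] ℝ} {p : E × E} {n : ℕ∞ω}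
    (hα : ContDiffAt ℝ n α p.1) : ContDiffAt ℝ n (tangentOneFormLocal α) p := by
  have h1 : ContDiffAt ℝ n (fun p : E × E =>
      (ContinuousAlternatingMap.curryLeftLI (𝕜 := ℝ) (E := E) (F := ℝ) (n := 1)) (α p.1)) p :=
    (LinearIsometry.contDiff _).contDiffAt.comp p (hα.comp p contDiffAt_fst)
  have h2 := h1.clm_apply contDiffAt_snd
  exact ((ContinuousAlternatingMap.compContinuousLinearMapCLM
    (ContinuousLinearMap.fst ℝ E E)).contDiff.contDiffAt.comp p h2).neg

theorem tangentOneForm_inChart_eqOn (Ω : DiffForm I M 2) (δz : TangentBundle I M) :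
    EqOn ((tangentOneForm Ω).inChart δz) (tangentOneFormLocal (Ω.inChart δz.proj))
      (extChartAt I.tangent δz).target := by
  intro p hp
  ext v
  have : v = ![v 0] := by
    funext i
    fin_cases i; rfl
  rw [this, tangentOneFormLocal_apply]
  exact tangentOneForm_inChart Ω (mem_extChartAt_tangent_target.1 hp) (v 0)

theorem tangentOneForm_isSmooth {Ω : DiffForm I M 2} (hΩ : Ω.IsSmooth) :
    (tangentOneForm Ω).IsSmooth := by
  intro δz
  refine ContDiffOn.congr (fun p hp => ?_) (tangentOneForm_inChart_eqOn Ω δz)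
  have hp' := mem_extChartAt_tangent_target.1 hp
  exact (ContDiffAt.tangentOneFormLocal
    ((hΩ _).contDiffAt (extChartAt_target_mem_nhds' hp'))).contDiffWithinAt

/-- At the centre of a chart, `-dΘ` is the tangent lift of the closed form `Ω`:
`-dΘ(u, v) = Ω(u.1, v.2) + Ω(u.2, v.1) + (D_w Ω)(u.1, v.1)` at the tangent vector `w`. Closedness
of `Ω` combines the two derivatives of `Ω` in `-dΘ` into the single one along `w`. -/
theorem tangentSymplecticForm_apply {Ω : DiffForm I M 2} (hΩ : Ω.IsSmooth)
    (δz : TangentBundle I M) (hd : Ω.d δz.proj = 0) (u v : E × E) :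
    tangentSymplecticForm Ω δz ![u, v] =
      Ω δz.proj ![u.1, v.2] + Ω δz.proj ![u.2, v.1] +
        fderiv ℝ (Ω.inChart δz.proj) (extChartAt I δz.proj δz.proj) δz.2 ![u.1, v.1] := by
  have hc := extChartAt_tangent_self δz
  set x := extChartAt I δz.proj δz.proj
  set w : E := δz.2
  set α := Ω.inChart δz.proj with hα
  have hx : x ∈ (extChartAt I δz.proj).target := mem_extChartAt_target _
  have hαd : DifferentiableAt ℝ α x := hΩ.differentiableAt hx
  have hαx : (α x : E [⋀^Fin 2]→L[ℝ] ℝ) = Ω δz.proj := Ω.inChart_self δz.proj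
  have hθd : DifferentiableAt ℝ ((tangentOneForm Ω).inChart δz) (x, w) := by
    have h := (tangentOneForm_isSmooth hΩ).differentiableAt (mem_extChartAt_target δz)
    exact (congrArg (DifferentiableAt ℝ ((tangentOneForm Ω).inChart δz)) hc).mp h
  have hfd : ∀ v₁ u₁ : E × E,
      fderiv ℝ (fun p => (tangentOneForm Ω).inChart δz p ![v₁]) (x, w) u₁ =
        fderiv ℝ α x u₁.1 ![v₁.1, w] + α x ![v₁.1, u₁.2] := by
    intro v₁ u₁
    have hev : (fun p => (tangentOneForm Ω).inChart δz p ![v₁]) =ᶠ[𝓝 (x, w)]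
        fun p => (α ∘ Prod.fst) p ![v₁.1, p.2] := by
      have hmem : (extChartAt I.tangent δz).target ∈ 𝓝 (x, w) :=
        extChartAt_target_mem_nhds' (mem_extChartAt_tangent_target.2 hx)
      filter_upwards [hmem] with p hp
      exact tangentOneForm_inChart Ω (mem_extChartAt_tangent_target.1 hp) v₁
    obtain ⟨L, hL, hL'⟩ := hasFDerivAt_two_form_apply
      (HasFDerivAt.comp (x, w) (f := Prod.fst) hαd.hasFDerivAt (hasFDerivAt_fst (𝕜 := ℝ)))
      (hasFDerivAt_const v₁.1 (x, w)) (hasFDerivAt_snd (𝕜 := ℝ) (p := (x, w)))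
    rw [hev.fderiv_eq, hL.fderiv, hL']
    have h0 : α x ![0, w] = 0 := (α x).map_coord_zero 0 rfl
    simp [h0]
  -- Closedness of `Ω`, evaluated on `u.1`, `v.1` and the base vector `w`.
  have hcl : extDeriv α x = 0 := by
    rw [← DiffForm.d_eq]
    exact hd
  have hcl' := extDeriv_two_form_apply (α := α) (x := x) u.1 v.1 w
  rw [hcl] at hcl'
  -- The types are unfolded to `E × E`, on which the calculus lemmas are stated.
  have hneg : tangentSymplecticForm Ω δz ![u, v] =
      -(extDeriv ((tangentOneForm Ω).inChart δz) (x, w) ![u, v]) := by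
    unfold tangentSymplecticForm
    rw [DiffForm.d_eq, hc]
    rfl
  have hsum : -(extDeriv ((tangentOneForm Ω).inChart δz) (x, w) ![u, v]) =
      α x ![u.1, v.2] + α x ![u.2, v.1] + fderiv ℝ α x w ![u.1, v.1] := by
    have h0 : (0 : E [⋀^Fin 3]→L[ℝ] ℝ) ![u.1, v.1, w] = 0 := rfl
    have h1 := extDeriv_one_form_apply hθd u v
    rw [hfd, hfd] at h1
    rw [h1, ContinuousAlternatingMap.map_two_swap (α x) u.2]
    linarith
  rw [hαx] at hsum
  exact hneg.trans hsum

end TangentForms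

/-! ### The symplectic structure of the tangent bundle -/

section TangentSymplectic

variable {E : Type*} [NormedAddCommGroup E] [NormedSpace ℝ E]
  {H : Type*} [TopologicalSpace H] {I : ModelWithCorners ℝ E H}
  {M : Type*} [TopologicalSpace M] [ChartedSpace H M]

theorem DiffForm.neg_inChart {n : ℕ} (η : DiffForm I M n) (x : M) :
    DiffForm.inChart (fun z => -η z) x = -η.inChart x := by
  funext y
  rfl

theorem DiffForm.IsSmooth.neg {n : ℕ} {η : DiffForm I M n} (hη : η.IsSmooth) :
    DiffForm.IsSmooth (fun z => -η z : DiffForm I M n) := by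
  intro x
  rw [DiffForm.neg_inChart]
  exact (hη x).neg

theorem DiffForm.d_neg [IsManifold I ∞ M] {n : ℕ} (η : DiffForm I M n) (x : M) :
    DiffForm.d (fun z => -η z : DiffForm I M n) x = -η.d x := by
  rw [DiffForm.d_eq, DiffForm.d_eq, DiffForm.neg_inChart]
  have : -η.inChart x = (-1 : ℝ) • η.inChart x := (neg_one_smul ℝ _).symm
  rw [this, extDeriv_smul, neg_one_smul]
  rfl

variable [I.Boundaryless] [IsManifold I ∞ M]

theorem DiffForm.IsSmooth.d {n : ℕ} {η : DiffForm I M n} (hη : η.IsSmooth) : η.d.IsSmooth := by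
  intro x
  refine ContDiffOn.congr (fun y hy => ?_) (fun y hy => η.d_inChart hη hy)
  exact (contDiffAt_extDeriv ((hη x).contDiffAt
    (extChartAt_target_mem_nhds' hy))).contDiffWithinAt

theorem DiffForm.d_d {n : ℕ} {η : DiffForm I M n} (hη : η.IsSmooth) (x : M) : η.d.d x = 0 := by
  have hx := mem_extChartAt_target (I := I) x
  have hev : η.d.inChart x =ᶠ[𝓝 (extChartAt I x x)] extDeriv (η.inChart x) := by
    filter_upwards [extChartAt_target_mem_nhds' hx] with y hy
    exact η.d_inChart hη hy
  rw [DiffForm.d_eq, hev.extDeriv_eq]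
  refine extDeriv_extDeriv_apply (r := ∞)
    ((hη x).contDiffAt (extChartAt_target_mem_nhds' hx)) minSmoothness_two_le_infty

/-- Nondegeneracy is read off from the local formula: vertical test vectors detect the first
component of `v`, and once it vanishes horizontal ones detect the second. -/
theorem isSymplecticForm_tangentSymplecticForm {Ω : DiffForm I M 2} (hΩ : IsSymplecticForm Ω) :
    IsSymplecticForm (tangentSymplecticForm Ω) where
  smooth := (tangentOneForm_isSmooth hΩ.smooth).d.neg
  closed δz := by
    refine (DiffForm.d_neg _ δz).trans ?_
    rw [DiffForm.d_d (tangentOneForm_isSmooth hΩ.smooth), neg_zero]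
  nondegenerate δz v hv := by
    have hform := tangentSymplecticForm_apply hΩ.smooth δz (hΩ.closed _) v
    have h0 : ∀ a : E, (Ω δz.proj : E [⋀^Fin 2]→L[ℝ] ℝ) ![a, 0] = 0 := fun a =>
      (Ω δz.proj : E [⋀^Fin 2]→L[ℝ] ℝ).map_coord_zero 1 rfl
    have h0' : ∀ a : E, (Ω δz.proj : E [⋀^Fin 2]→L[ℝ] ℝ) ![0, a] = 0 := fun a =>
      (Ω δz.proj : E [⋀^Fin 2]→L[ℝ] ℝ).map_coord_zero 0 rfl
    set D := fderiv ℝ (Ω.inChart δz.proj) (extChartAt I δz.proj δz.proj) δz.2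
    have hD0 : ∀ a : E, D ![a, 0] = 0 := fun a => D.map_coord_zero 1 rfl
    have hD0' : ∀ a : E, D ![0, a] = 0 := fun a => D.map_coord_zero 0 rfl
    have hv1 : (v : E × E).1 = 0 := by
      refine hΩ.nondegenerate δz.proj _ fun w => ?_
      have h := (hform (0, w)).symm.trans (hv _)
      have e1 := h0 (v : E × E).2
      have e2 := hD0 (v : E × E).1
      exact (add_zero _).symm.trans <| (add_zero _).symm.trans <|
        (congrArg₂ _ (congrArg _ e1.symm) e2.symm).trans h
    have hv2 : (v : E × E).2 = 0 := by
      refine hΩ.nondegenerate δz.proj _ fun w => ?_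
      have h := (hform (w, 0)).symm.trans (hv _)
      have e1 := h0 (v : E × E).1
      have e2 := hD0' w
      rw [← hv1] at e2
      exact (zero_add _).symm.trans <| (add_zero _).symm.trans <|
        (congrArg₂ _ (congrArg (· + _) e1.symm) e2.symm).trans h
    exact Prod.ext hv1 hv2

end TangentSymplectic

/-! ### Lifts of functions and of Hamiltonian vector fields -/

section TangentLift

variable {E : Type*} [NormedAddCommGroup E] [NormedSpace ℝ E]
  {H : Type*} [TopologicalSpace H] {I : ModelWithCorners ℝ E H}
  {M : Type*} [TopologicalSpace M] [ChartedSpace H M]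
  {F : Type*} [NormedAddCommGroup F] [NormedSpace ℝ F]

theorem tangentLift_clm_apply {V : Type*} [NormedAddCommGroup V] [NormedSpace ℝ V]
    {J : M → V →L[ℝ] ℝ} (hJ : ContMDiff I 𝓘(ℝ, V →L[ℝ] ℝ) ∞ J) (ξ : V) (δz : TangentBundle I M) :
    tangentLift (fun x => J x ξ) δz = tangentLift J δz ξ := by
  have h := mfderiv_comp δz.proj (g := ContinuousLinearMap.apply ℝ ℝ ξ)
    (ContinuousLinearMap.mdifferentiableAt _) (hJ.mdifferentiable (by simp) δz.proj)
  rw [ContinuousLinearMap.mfderiv_eq] at h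
  exact DFunLike.congr_fun h δz.2

variable [IsManifold I ∞ M]

theorem contMDiff_tangentLift {f : M → F} (hf : ContMDiff I 𝓘(ℝ, F) ∞ f) :
    ContMDiff I.tangent 𝓘(ℝ, F) ∞ (tangentLift (I := I) f) :=
  (contMDiff_snd_tangentBundle_modelSpace (I := 𝓘(ℝ, F)) (H := F)).comp
    (hf.contMDiff_tangentMap (m := ∞) (by simp))

variable [I.Boundaryless]

/-- In the chart `(a, b)` of the tangent bundle, the lift of `f` is `Df(a) b`. -/
theorem tangentLift_symm_apply {f : M → F} (hf : ContMDiff I 𝓘(ℝ, F) ∞ f) {δz : TangentBundle I M}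
    {p : E × E} (hp : p.1 ∈ (extChartAt I δz.proj).target) :
    tangentLift f ((extChartAt I.tangent δz).symm p) =
      fderiv ℝ (f ∘ (extChartAt I δz.proj).symm) p.1 p.2 := by
  rw [extChartAt_tangent_symm_apply p.2 hp, ← mfderiv_eq_fderiv,
    mfderiv_comp p.1 (hf.mdifferentiable (by simp) _) (mdifferentiableAt_extChartAt_symm hp)]
  rfl

theorem contDiffAt_comp_extChartAt_symm {f : M → F} (hf : ContMDiff I 𝓘(ℝ, F) ∞ f) {x : M} {y : E}
    (hy : y ∈ (extChartAt I x).target) : ContDiffAt ℝ ∞ (f ∘ (extChartAt I x).symm) y :=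
  (hf.contMDiffAt.comp y (contMDiffAt_extChartAt_symm hy)).contDiffAt

theorem mfderiv_tangentLift_apply {f : M → F} (hf : ContMDiff I 𝓘(ℝ, F) ∞ f)
    (δz : TangentBundle I M) (v : E × E) :
    (mfderiv I.tangent 𝓘(ℝ, F) (tangentLift f) δz v : F) =
      fderiv ℝ (fderiv ℝ (f ∘ (extChartAt I δz.proj).symm)) (extChartAt I δz.proj δz.proj) v.1 δz.2
      + fderiv ℝ (f ∘ (extChartAt I δz.proj).symm) (extChartAt I δz.proj δz.proj) v.2 := by
  set x := extChartAt I δz.proj δz.proj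
  set w : E := δz.2
  have hx : x ∈ (extChartAt I δz.proj).target := mem_extChartAt_target _
  have hc : extChartAt I.tangent δz δz = ((x, w) : E × E) := extChartAt_tangent_self δz
  have hev : extChartAt 𝓘(ℝ, F) (tangentLift f δz) ∘ tangentLift f ∘
      (extChartAt I.tangent δz).symm =ᶠ[𝓝 (x, w)]
        fun p => (fderiv ℝ (f ∘ (extChartAt I δz.proj).symm) ∘ Prod.fst) p p.2 := by
    filter_upwards [extChartAt_target_mem_nhds' (mem_extChartAt_tangent_target.2 hx)] with p hp
    exact tangentLift_symm_apply hf (mem_extChartAt_tangent_target.1 hp)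
  have hdiff : DifferentiableAt ℝ (fderiv ℝ (f ∘ (extChartAt I δz.proj).symm)) x :=
    ((contDiffAt_comp_extChartAt_symm hf hx).fderiv_right (m := ∞) (by simp)).differentiableAt
      (by simp)
  have hder := (HasFDerivAt.comp (x, w) (f := Prod.fst) hdiff.hasFDerivAt
    (hasFDerivAt_fst (𝕜 := ℝ))).clm_apply (hasFDerivAt_snd (𝕜 := ℝ) (p := (x, w)))
  have hm := mfderiv_eq_fderiv_writtenInExtChartAt
    ((contMDiff_tangentLift hf).mdifferentiable (by simp) δz)
  rw [hc, hev.fderiv_eq, hder.fderiv] at hm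
  exact (DFunLike.congr_fun hm v).trans (add_comm _ _)

/-- If `X` is the Hamiltonian vector field of `f`, then its complete lift is the Hamiltonian vector
field of the lift of `f`. In the chart at the base point the complete lift at the tangent vector `w` is
`(X, D w)`, where `D` is the derivative of the local representative of `X`; the claim is the
derivative along `w` of the identity `Ω(X, b) = Df b`. -/
theorem tangentSymplecticForm_lift {Ω : DiffForm I M 2} (hΩ : Ω.IsSmooth) (hd : ∀ x, Ω.d x = 0)
    {f : M → ℝ} (hf : ContMDiff I 𝓘(ℝ, ℝ) ∞ f) {X : (x : M) → TangentSpace I x}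
    (hX : IsHamiltonianVectorField Ω f X) (δz : TangentBundle I M) {D : E →L[ℝ] E}
    (hD : HasFDerivAt (fun y => (mfderiv I 𝓘(ℝ, E) (extChartAt I δz.proj)
      ((extChartAt I δz.proj).symm y) (X ((extChartAt I δz.proj).symm y)) : E)) D
      (extChartAt I δz.proj δz.proj)) (v : E × E) :
    tangentSymplecticForm Ω δz ![((X δz.proj, D δz.2) : E × E), v] =
      mfderiv I.tangent 𝓘(ℝ, ℝ) (tangentLift f) δz v := by
  set x := extChartAt I δz.proj δz.proj
  set w : E := δz.2
  set α := Ω.inChart δz.proj with hα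
  set X' : E → E := fun y => mfderiv I 𝓘(ℝ, E) (extChartAt I δz.proj)
      ((extChartAt I δz.proj).symm y) (X ((extChartAt I δz.proj).symm y)) with hX'
  set f' := f ∘ (extChartAt I δz.proj).symm
  have hx : x ∈ (extChartAt I δz.proj).target := mem_extChartAt_target _
  -- The Hamiltonian condition in the chart; it holds near `x`, so that it can be differentiated.
  have hham : ∀ y ∈ (extChartAt I δz.proj).target, ∀ b : E, α y ![X' y, b] = fderiv ℝ f' y b := by
    intro y hy b
    rw [← mfderiv_eq_fderiv,
      mfderiv_comp y (hf.mdifferentiable (by simp) _) (mdifferentiableAt_extChartAt_symm hy)]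
    refine Eq.trans ?_ (hX ((extChartAt I δz.proj).symm y)
      (mfderiv 𝓘(ℝ, E) I (extChartAt I δz.proj).symm y b))
    refine congrArg (Ω _) ?_
    funext i
    fin_cases i
    · exact mfderiv_symm_mfderiv_extChartAt hy _
    · rfl
  have hf'2 := contDiffAt_comp_extChartAt_symm hf hx
  have hdiff : DifferentiableAt ℝ (fderiv ℝ f') x :=
    (hf'2.fderiv_right (m := ∞) (by simp)).differentiableAt (by simp)
  have hXx : X' x = X δz.proj := mfderiv_extChartAt_vectorField_self X δz.proj
  have hαx : (α x : E [⋀^Fin 2]→L[ℝ] ℝ) = Ω δz.proj := Ω.inChart_self δz.proj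
  obtain ⟨L, hL, hL'⟩ := hasFDerivAt_two_form_apply (hΩ.differentiableAt hx).hasFDerivAt hD
    (hasFDerivAt_const v.1 x)
  have hev : (fun y => α y ![X' y, v.1]) =ᶠ[𝓝 x] fun y => fderiv ℝ f' y v.1 := by
    filter_upwards [extChartAt_target_mem_nhds' hx] with y hy using hham y hy _
  have hR := (hdiff.hasFDerivAt.clm_apply (hasFDerivAt_const v.1 x)).congr_of_eventuallyEq hev
  have hLw := DFunLike.congr_fun (hL.unique hR) w
  rw [hL'] at hLw
  have h0 : α x ![X' x, 0] = 0 := (α x).map_coord_zero 1 rfl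
  have hsymm := (hf'2.isSymmSndFDerivAt minSmoothness_two_le_infty).eq w v.1
  have key : α x ![X' x, v.2] + α x ![D w, v.1] + fderiv ℝ α x w ![X' x, v.1] =
      fderiv ℝ (fderiv ℝ f') x v.1 w + fderiv ℝ f' x v.2 := by
    rw [hham x hx, ← hsymm]
    simp at hLw
    linarith
  rw [hαx, hXx] at key
  exact ((tangentSymplecticForm_apply hΩ δz (hd _) _ v).trans key).trans
    (mfderiv_tangentLift_apply hf δz v).symm

end TangentLift

/-! ### One-parameter subgroups -/

section LieExp

variable {EG : Type*} [NormedAddCommGroup EG] [NormedSpace ℝ EG]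
  {HG : Type*} [TopologicalSpace HG] {IG : ModelWithCorners ℝ EG HG}
  {G : Type*} [TopologicalSpace G] [ChartedSpace HG G] [Group G]

theorem mulInvariantVectorField_one (ξ : GroupLieAlgebra IG G) :
    (mulInvariantVectorField ξ (1 : G) : EG) = ξ := by
  have h : (fun g : G => 1 * g) = id := by
    funext g
    simp
  unfold mulInvariantVectorField
  rw [h, mfderiv_id]
  rfl

variable [LieGroup IG ∞ G]

/-- Left translations preserve left-invariant vector fields. -/
theorem mfderiv_mul_left_mulInvariantVectorField (ξ : GroupLieAlgebra IG G) (g k : G) :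
    mfderiv IG IG (g * ·) k (mulInvariantVectorField ξ k) = mulInvariantVectorField ξ (g * k) := by
  have hs : ∀ a : G, MDifferentiable IG IG (a * · : G → G) := fun a =>
    (contMDiff_mul_left (I := IG) (n := ∞)).mdifferentiable (by simp)
  have h : (g * k * · : G → G) = (g * ·) ∘ (k * ·) := by
    funext a
    simp [mul_assoc]
  have h1 : (mfderiv IG IG (g * ·) k : EG →L[ℝ] EG) = mfderiv IG IG (g * ·) (k * 1) := by
    rw [mul_one]
  unfold mulInvariantVectorField
  rw [h, mfderiv_comp (I' := IG) (1 : G) (hs g _) (hs k _)]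
  exact DFunLike.congr_fun h1 _

theorem IsMIntegralCurveOn.mul_left {ξ : GroupLieAlgebra IG G} {γ : ℝ → G} {s : Set ℝ}
    (hγ : IsMIntegralCurveOn γ (mulInvariantVectorField ξ) s) (g : G) :
    IsMIntegralCurveOn (fun t => g * γ t) (mulInvariantVectorField ξ) s := by
  intro t ht
  have hs : MDifferentiable IG IG (g * · : G → G) :=
    (contMDiff_mul_left (I := IG) (n := ∞)).mdifferentiable (by simp)
  have h := (hs (γ t)).hasMFDerivAt.comp_hasMFDerivWithinAt t (hγ t ht)
  refine h.congr_mfderiv ?_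
  refine ContinuousLinearMap.ext_ring ?_
  have h1 := mfderiv_mul_left_mulInvariantVectorField ξ g (γ t)
  refine (Eq.trans (congrArg (mfderiv IG IG (g * ·) (γ t)) (one_smul ℝ _)) h1).trans ?_
  exact (one_smul ℝ _).symm

theorem contMDiff_one_mulInvariantVectorField (ξ : GroupLieAlgebra IG G) :
    haveI : IsManifold IG 1 G := IsManifold.of_le (n := ∞) (by simp)
    ContMDiff IG IG.tangent 1
      (fun g : G => (⟨g, mulInvariantVectorField ξ g⟩ : TangentBundle IG G)) := by
  have : LieGroup IG (minSmoothness ℝ 3) G := by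
    rw [minSmoothness_of_isRCLikeNormedField]
    exact LieGroup.of_le (n := ∞) (WithTop.coe_le_coe.2 (le_top : (3 : ℕ∞) ≤ ⊤))
  refine (contMDiff_mulInvariantVectorField ξ).of_le ?_
  rw [minSmoothness_of_isRCLikeNormedField]
  norm_num

variable [CompleteSpace EG] [IG.Boundaryless] [T2Space G]

/-- Left-invariant vector fields are complete: the left translates of an integral curve through `1`
give integral curves through all points with the same time of existence. -/
theorem exists_isMIntegralCurve_mulInvariantVectorField (ξ : GroupLieAlgebra IG G) :
    ∃ γ : ℝ → G, γ 0 = 1 ∧ IsMIntegralCurve γ (mulInvariantVectorField ξ) := by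
  have : IsManifold IG 1 G := IsManifold.of_le (n := ∞) (by simp)
  have hv := contMDiff_one_mulInvariantVectorField (G := G) ξ
  obtain ⟨γ, hγ0, hγ⟩ := exists_isMIntegralCurveAt_of_contMDiffAt_boundaryless (I := IG) 0
    (hv.contMDiffAt (x := 1))
  obtain ⟨ε, hε, hγε⟩ := isMIntegralCurveAt_iff'.1 hγ
  rw [Real.ball_eq_Ioo] at hγε
  refine exists_isMIntegralCurve_of_isMIntegralCurveOn hv hε (fun g => ?_) 1
  refine ⟨fun t => g * γ t, by simp [hγ0], ?_⟩
  simpa using hγε.mul_left g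

/-- The curve `t ↦ exp (t ξ)` is the integral curve of the left-invariant vector field of `ξ`: the
value of `lieExp` does not depend on the choice in its definition, as integral curves are unique. -/
theorem exists_lieExp_smul_eq (ξ : GroupLieAlgebra IG G) :
    ∃ γ : ℝ → G, γ 0 = 1 ∧ IsMIntegralCurve γ (mulInvariantVectorField ξ) ∧
      ∀ t : ℝ, lieExp (t • ξ) = γ t := by
  obtain ⟨γ, h0, hγ⟩ := exists_isMIntegralCurve_mulInvariantVectorField ξ
  refine ⟨γ, h0, hγ, fun t => ?_⟩
  have : IsManifold IG 1 G := IsManifold.of_le (n := ∞) (by simp)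
  obtain ⟨he0, he⟩ := Classical.epsilon_spec
    (exists_isMIntegralCurve_mulInvariantVectorField (t • ξ))
  have hγt : IsMIntegralCurve (γ ∘ (· * t)) (mulInvariantVectorField (t • ξ)) := by
    have hsmul : mulInvariantVectorField (t • ξ) = t • mulInvariantVectorField (G := G) ξ :=
      mulInvariantVectorField_smul t ξ
    rw [hsmul]
    exact hγ.comp_mul t
  have heq := isMIntegralCurve_Ioo_eq_of_contMDiff_boundaryless (t₀ := 0)
    (contMDiff_one_mulInvariantVectorField (t • ξ)) he hγt (by simp [he0, h0])
  refine (congrFun heq 1).trans ?_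
  simp

theorem lieExp_zero_smul (ξ : GroupLieAlgebra IG G) : lieExp ((0 : ℝ) • ξ) = (1 : G) := by
  obtain ⟨γ, h0, -, h⟩ := exists_lieExp_smul_eq ξ
  rw [h, h0]

theorem hasMFDerivAt_lieExp_smul (ξ : GroupLieAlgebra IG G) :
    HasMFDerivAt 𝓘(ℝ, ℝ) IG (fun t : ℝ => (lieExp (t • ξ) : G)) 0
      (ContinuousLinearMap.toSpanSingleton ℝ (ξ : EG)) := by
  obtain ⟨γ, h0, hγ, h⟩ := exists_lieExp_smul_eq ξ
  have hfun : (fun t : ℝ => (lieExp (t • ξ) : G)) = γ := funext h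
  rw [hfun]
  refine (hγ 0).congr_mfderiv ?_
  refine ContinuousLinearMap.ext_ring ?_
  have h1 : (mulInvariantVectorField ξ (γ 0) : EG) = ξ := by
    rw [h0]
    exact mulInvariantVectorField_one ξ
  exact congrArg (fun v : EG => (1 : ℝ) • v) h1

end LieExp

/-! ### Generators of smooth actions -/

section Generator

variable {E : Type*} [NormedAddCommGroup E] [NormedSpace ℝ E]
  {H : Type*} [TopologicalSpace H] {I : ModelWithCorners ℝ E H}
  {M : Type*} [TopologicalSpace M] [ChartedSpace H M]
  {EG : Type*} [NormedAddCommGroup EG] [NormedSpace ℝ EG]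
  {HG : Type*} [TopologicalSpace HG] {IG : ModelWithCorners ℝ EG HG}
  {G : Type*} [TopologicalSpace G] [ChartedSpace HG G] [Group G]
  {Φ : G → M → M}

theorem IsSmoothAction.contMDiff_orbit (hΦ : IsSmoothAction I IG Φ) (x : M) :
    ContMDiff IG I ∞ (fun g => Φ g x) :=
  hΦ.smooth.comp (contMDiff_id.prodMk contMDiff_const)

theorem IsSmoothAction.contMDiff_apply (hΦ : IsSmoothAction I IG Φ) (g : G) :
    ContMDiff I I ∞ (Φ g) :=
  hΦ.smooth.comp (contMDiff_const.prodMk contMDiff_id)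

variable [LieGroup IG ∞ G] [CompleteSpace EG] [IG.Boundaryless] [T2Space G]

/-- The generator is the derivative at `1` of the orbit map. The right-hand side lies in the tangent
space at `Φ 1 x`; both sides are compared as vectors of `E`. -/
theorem IsSmoothAction.infinitesimalGenerator_eq (hΦ : IsSmoothAction I IG Φ)
    (ξ : GroupLieAlgebra IG G) (x : M) :
    (infinitesimalGenerator I Φ ξ x : E) = mfderiv IG I (fun g => Φ g x) 1 ξ := by
  have h1 := hasMFDerivAt_lieExp_smul ξ
  have h2 := ((hΦ.contMDiff_orbit x).mdifferentiable (by simp)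
    (lieExp ((0 : ℝ) • ξ))).hasMFDerivAt.comp (0 : ℝ) h1
  have h3 : (mfderiv IG I (fun g => Φ g x) (lieExp ((0 : ℝ) • ξ)) : EG →L[ℝ] E) =
      mfderiv IG I (fun g => Φ g x) 1 := by
    rw [lieExp_zero_smul]
  unfold infinitesimalGenerator
  have h4 := DFunLike.congr_fun h2.mfderiv (1 : ℝ)
  refine Eq.trans h4 ?_
  refine (congrArg (mfderiv IG I (fun g => Φ g x) (lieExp ((0 : ℝ) • ξ))) (one_smul ℝ _)).trans ?_
  exact DFunLike.congr_fun h3 _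

theorem IsSmoothAction.mfderiv_invariant_generator (hΦ : IsSmoothAction I IG Φ)
    {f : M → ℝ} (hf : ContMDiff I 𝓘(ℝ, ℝ) ∞ f) (hinv : ∀ g x, f (Φ g x) = f x)
    (ξ : GroupLieAlgebra IG G) (x : M) :
    mfderiv I 𝓘(ℝ, ℝ) f x (infinitesimalGenerator I Φ ξ x) = (0 : ℝ) := by
  have hconst : f ∘ (fun g => Φ g x) = fun _ => f x := by
    funext g
    exact hinv g x
  have hc := mfderiv_comp (1 : G) (hf.mdifferentiable (by simp) (Φ 1 x))
    ((hΦ.contMDiff_orbit x).mdifferentiable (by simp) (1 : G))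
  rw [hconst, mfderiv_const] at hc
  have h1 : (mfderiv I 𝓘(ℝ, ℝ) f x : E →L[ℝ] ℝ) = mfderiv I 𝓘(ℝ, ℝ) f (Φ 1 x) := by
    rw [hΦ.one]
  rw [hΦ.infinitesimalGenerator_eq]
  exact (DFunLike.congr_fun h1 _).trans (DFunLike.congr_fun hc ξ).symm

end Generator

/-! ### The tangent action -/

section TangentAction

variable {E : Type*} [NormedAddCommGroup E] [NormedSpace ℝ E]
  {H : Type*} [TopologicalSpace H] {I : ModelWithCorners ℝ E H}
  {M : Type*} [TopologicalSpace M] [ChartedSpace H M] [IsManifold I ∞ M]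
  {EG : Type*} [NormedAddCommGroup EG] [NormedSpace ℝ EG]
  {HG : Type*} [TopologicalSpace HG] {IG : ModelWithCorners ℝ EG HG}
  {G : Type*} [TopologicalSpace G] [ChartedSpace HG G] [Group G]
  {Φ : G → M → M}

/-- Smoothness of the tangent action: `TΦ_g` is the tangent map of the action `G × M → M` at vectors
whose `G`-component is zero. -/
theorem IsSmoothAction.tangentAction [IsManifold IG ∞ G] (hΦ : IsSmoothAction I IG Φ) :
    IsSmoothAction I.tangent IG (tangentAction I Φ) where
  one δz := by
    have h : Φ 1 = id := funext hΦ.one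
    unfold SymplecticNoether.tangentAction
    rw [h, tangentMap_id, id]
  mul g k δz := by
    have h : Φ (g * k) = Φ g ∘ Φ k := funext (hΦ.mul g k)
    unfold SymplecticNoether.tangentAction
    rw [h, tangentMap_comp ((hΦ.contMDiff_apply g).mdifferentiable (by simp))
      ((hΦ.contMDiff_apply k).mdifferentiable (by simp))]
    rfl
  smooth := by
    -- `(g, δz) ↦ (0_g, δz)` is smooth into the tangent bundle of `G × M`.
    have hzero : ContMDiff IG IG.tangent ∞ (fun g : G => (⟨g, 0⟩ : TangentBundle IG G)) :=
      contMDiff_zeroSection _ _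
    have hT := hΦ.smooth.contMDiff_tangentMap (m := ∞) (by simp)
    have hS := (hT.comp (contMDiff_equivTangentBundleProd_symm (I := IG) (I' := I) (M := G)
      (M' := M))).comp ((hzero.comp contMDiff_fst).prodMk
        (contMDiff_snd (I := IG) (M := G) (J := I.tangent) (N := TangentBundle I M)))
    refine hS.congr fun p => ?_
    have hadd := fun v : EG × E => mfderiv_prod_eq_add_apply (v := v)
      (hΦ.smooth.mdifferentiable (by simp) (p.1, p.2.proj))
    refine TotalSpace.ext rfl (heq_of_eq ?_)
    refine Eq.trans ?_ (hadd (0, p.2.2)).symm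
    change (mfderiv I I (Φ p.1) p.2.proj p.2.2 : E) = (mfderiv IG I (fun g => Φ g p.2.proj) p.1
      (0 : EG) : E) + (mfderiv I I (Φ p.1) p.2.proj p.2.2 : E)
    refine (zero_add _).symm.trans (congrArg (· + _) ?_)
    exact (ContinuousLinearMap.map_zero (mfderiv IG I (fun g => Φ g p.2.proj) p.1)).symm

/-- The one-form is preserved because `Tτ` intertwines `T(TΦ_g)` and `TΦ_g`, and `Φ_g` preserves
`Ω`. -/
theorem pullback_tangentOneForm {Ω : DiffForm I M 2} (hΦ : IsSymplecticAction IG Ω Φ) (g : G)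
    (δz : TangentBundle I M) :
    (tangentOneForm Ω).pullback (tangentAction I Φ g) δz = tangentOneForm Ω δz := by
  have hg := hΦ.contMDiff_apply g
  have hT : MDifferentiableAt I.tangent I.tangent (tangentAction I Φ g) δz :=
    (hg.contMDiff_tangentMap (m := ∞) (by simp)).mdifferentiable (by simp) δz
  have h1 := mfderiv_comp δz (mdifferentiableAt_tangentBundle_proj (tangentAction I Φ g δz)) hT
  have h2 := mfderiv_comp δz (hg.mdifferentiable (by simp) δz.proj)
    (mdifferentiableAt_tangentBundle_proj δz)
  have h3 : (TotalSpace.proj : TangentBundle I M → M) ∘ tangentAction I Φ g =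
      Φ g ∘ TotalSpace.proj := rfl
  rw [h3, h2] at h1
  ext v
  have hv : v = ![v 0] := by
    funext i
    fin_cases i; rfl
  have hpush : (fun i => mfderiv I.tangent I.tangent (tangentAction I Φ g) δz (![v 0] i)) =
      ![mfderiv I.tangent I.tangent (tangentAction I Φ g) δz (v 0)] := by
    funext i
    fin_cases i; rfl
  have hs := DFunLike.congr_fun (hΦ.symplectic g δz.proj)
    ![mfderiv I.tangent I (TotalSpace.proj : TangentBundle I M → M) δz (v 0), δz.2]
  rw [hv, tangentOneForm_apply, ← hs]
  change tangentOneForm Ω (tangentAction I Φ g δz)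
    (fun i => mfderiv I.tangent I.tangent (tangentAction I Φ g) δz (![v 0] i)) = _
  rw [hpush, tangentOneForm_apply]
  refine congrArg (Ω (Φ g δz.proj)) ?_
  funext i
  fin_cases i
  · exact (DFunLike.congr_fun h1 (v 0)).symm
  · rfl

theorem pullback_tangentSymplecticForm [I.Boundaryless] [IsManifold IG ∞ G] {Ω : DiffForm I M 2}
    (hΩ : Ω.IsSmooth)
    (hΦ : IsSymplecticAction IG Ω Φ) (g : G) (δz : TangentBundle I M) :
    (tangentSymplecticForm Ω).pullback (tangentAction I Φ g) δz = tangentSymplecticForm Ω δz := by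
  have h := DiffForm.d_pullback (tangentOneForm_isSmooth hΩ)
    (hΦ.toIsSmoothAction.tangentAction.contMDiff_apply g)
  have h' : (tangentOneForm Ω).pullback (tangentAction I Φ g) = tangentOneForm Ω :=
    funext (pullback_tangentOneForm hΦ g)
  rw [h'] at h
  exact congrArg Neg.neg (congrFun h δz).symm

/-- The local expression of the action is smooth where it is defined. -/
theorem contDiffAt_action_inCharts [I.Boundaryless] [IG.Boundaryless]
    [IsManifold IG ∞ G] (hΦ : IsSmoothAction I IG Φ) {x : M} {g₀ : G} {p : EG × E}
    (hu : p.1 ∈ (extChartAt IG g₀).target) (hy : p.2 ∈ (extChartAt I x).target)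
    (hmem : Φ ((extChartAt IG g₀).symm p.1) ((extChartAt I x).symm p.2) ∈
      (extChartAt I x).source) :
    ContDiffAt ℝ ∞ (fun q : EG × E => extChartAt I x
      (Φ ((extChartAt IG g₀).symm q.1) ((extChartAt I x).symm q.2))) p := by
  rw [← contMDiffAt_iff_contDiffAt]
  have hfst : ContMDiffAt 𝓘(ℝ, EG × E) 𝓘(ℝ, EG) ∞ (Prod.fst : EG × E → EG) p :=
    contDiff_fst.contMDiff.contMDiffAt
  have hsnd : ContMDiffAt 𝓘(ℝ, EG × E) 𝓘(ℝ, E) ∞ (Prod.snd : EG × E → E) p :=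
    contDiff_snd.contMDiff.contMDiffAt
  have h1 := ((contMDiffAt_extChartAt_symm hu).comp p hfst).prodMk
    ((contMDiffAt_extChartAt_symm hy).comp p hsnd)
  exact (contMDiffAt_extChartAt' (by simpa using hmem)).comp p (hΦ.smooth.contMDiffAt.comp p h1)

variable [LieGroup IG ∞ G] [CompleteSpace EG] [IG.Boundaryless] [T2Space G]

theorem mfderiv_proj_infinitesimalGenerator (hΦ : IsSmoothAction I IG Φ) (ξ : GroupLieAlgebra IG G)
    (δz : TangentBundle I M) :
    (mfderiv I.tangent I (TotalSpace.proj : TangentBundle I M → M) δz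
      (infinitesimalGenerator I.tangent (tangentAction I Φ) ξ δz) : E) =
      infinitesimalGenerator I Φ ξ δz.proj := by
  have hT := hΦ.tangentAction
  rw [hT.infinitesimalGenerator_eq, hΦ.infinitesimalGenerator_eq]
  have h1 := mfderiv_comp (1 : G) (mdifferentiableAt_tangentBundle_proj (tangentAction I Φ 1 δz))
    ((hT.contMDiff_orbit δz).mdifferentiable (by simp) (1 : G))
  have h2 : (mfderiv I.tangent I (TotalSpace.proj : TangentBundle I M → M)
      (tangentAction I Φ 1 δz) : E × E →L[ℝ] E) = mfderiv I.tangent I TotalSpace.proj δz := by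
    rw [hT.one]
  exact (DFunLike.congr_fun h2 _).symm.trans (DFunLike.congr_fun h1 ξ).symm

variable [I.Boundaryless]

/-- The generator of the tangent action is the complete lift of the generator of the action. With
`F` the local expression of the action, the lift contains the derivative of `F` first in `M` and then
in `G`, and `D` the one in the opposite order, so this is the symmetry of the second derivative
of `F`. -/
theorem infinitesimalGenerator_tangentAction (hΦ : IsSmoothAction I IG Φ)
    (ξ : GroupLieAlgebra IG G) (δz : TangentBundle I M) :
    ∃ D : E →L[ℝ] E,
      HasFDerivAt (fun y => (mfderiv I 𝓘(ℝ, E) (extChartAt I δz.proj)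
        ((extChartAt I δz.proj).symm y)
        (infinitesimalGenerator I Φ ξ ((extChartAt I δz.proj).symm y)) : E)) D
        (extChartAt I δz.proj δz.proj) ∧
      infinitesimalGenerator I.tangent (tangentAction I Φ) ξ δz =
        ((infinitesimalGenerator I Φ ξ δz.proj, D δz.2) : E × E) := by
  set x := extChartAt I δz.proj δz.proj
  set φ := extChartAt I δz.proj
  set ψ := extChartAt IG (1 : G)
  set u₀ := ψ 1
  set w : E := δz.2
  set F : EG × E → E := fun q => φ (Φ (ψ.symm q.1) (φ.symm q.2)) with hF
  have hx : x ∈ φ.target := mem_extChartAt_target _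
  have hu₀ : u₀ ∈ ψ.target := mem_extChartAt_target _
  have hψu : ψ.symm u₀ = 1 := extChartAt_to_inv (I := IG) (1 : G)
  have hφx : φ.symm x = δz.proj := extChartAt_to_inv (I := I) δz.proj
  have hFx : ∀ y ∈ φ.target, ContDiffAt ℝ ∞ F (u₀, y) := fun y hy =>
    contDiffAt_action_inCharts hΦ hu₀ hy (by
      change Φ (ψ.symm u₀) (φ.symm y) ∈ φ.source
      rw [hψu, hΦ.one]
      exact φ.map_target hy)
  have hFu : ∀ᶠ u in 𝓝 u₀, u ∈ ψ.target ∧ Φ (ψ.symm u) (φ.symm x) ∈ φ.source := by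
    have hcont : ContinuousAt (fun u => Φ (ψ.symm u) (φ.symm x)) u₀ :=
      (hΦ.contMDiff_orbit (φ.symm x)).continuous.continuousAt.comp
        (contMDiffAt_extChartAt_symm hu₀).continuousAt
    have hψ : ∀ᶠ u in 𝓝 u₀, u ∈ ψ.target := extChartAt_target_mem_nhds' hu₀
    refine hψ.and (hcont.preimage_mem_nhds ?_)
    rw [hψu, hΦ.one, hφx]
    exact extChartAt_source_mem_nhds _
  -- The local representative of the generator is the partial derivative of `F` along `ξ`.
  have hgen : ∀ y ∈ φ.target, (mfderiv I 𝓘(ℝ, E) φ (φ.symm y)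
      (infinitesimalGenerator I Φ ξ (φ.symm y)) : E) = fderiv ℝ F (u₀, y) (ξ, 0) := by
    intro y hy
    have hmem : Φ 1 (φ.symm y) ∈ φ.source := by
      rw [hΦ.one]
      exact φ.map_target hy
    have hφd : MDifferentiableAt I 𝓘(ℝ, E) φ (Φ 1 (φ.symm y)) :=
      mdifferentiableAt_extChartAt (by simpa [φ] using hmem)
    have horb := (hΦ.contMDiff_orbit (φ.symm y)).mdifferentiable (by simp) (1 : G)
    have h1 := mfderiv_comp (1 : G) hφd horb
    have h2 := mfderiv_eq_fderiv_writtenInExtChartAt (hφd.comp (1 : G) horb)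
    have h3 := (HasFDerivAt.comp (g := F) (f := fun u => (u, y)) u₀
      ((hFx y hy).differentiableAt (by simp)).hasFDerivAt
      (hasFDerivAt_prodMk_left (𝕜 := ℝ) u₀ y)).fderiv
    have h4 : (mfderiv I 𝓘(ℝ, E) φ (φ.symm y) : E →L[ℝ] E) =
        mfderiv I 𝓘(ℝ, E) φ (Φ 1 (φ.symm y)) := by
      rw [hΦ.one]
    rw [hΦ.infinitesimalGenerator_eq]
    refine (DFunLike.congr_fun h4 _).trans ((DFunLike.congr_fun h1 ξ).symm.trans ?_)
    exact (DFunLike.congr_fun h2 ξ).trans (DFunLike.congr_fun h3 ξ)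
  -- The generator of the tangent action is the derivative along `ξ` of `(F, D₂F w)`.
  have hlift : infinitesimalGenerator I.tangent (tangentAction I Φ) ξ δz =
      (fderiv ℝ (fun u => ((F (u, x), fderiv ℝ F (u, x) (0, w)) : E × E)) u₀ ξ : E × E) := by
    have hT := hΦ.tangentAction
    have hm := mfderiv_eq_fderiv_writtenInExtChartAt
      ((hT.contMDiff_orbit δz).mdifferentiable (by simp) (1 : G))
    have hchart : extChartAt I.tangent (tangentAction I Φ 1 δz) = extChartAt I.tangent δz := by
      rw [hT.one]
    rw [hchart] at hm
    have hev : extChartAt I.tangent δz ∘ (fun g => tangentAction I Φ g δz) ∘ ψ.symm =ᶠ[𝓝 u₀]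
        fun u => ((F (u, x), fderiv ℝ F (u, x) (0, w)) : E × E) := by
      filter_upwards [hFu] with u hu
      have hmem : Φ (ψ.symm u) δz.proj ∈ φ.source := hφx ▸ hu.2
      have hφd : MDifferentiableAt I 𝓘(ℝ, E) φ (Φ (ψ.symm u) δz.proj) :=
        mdifferentiableAt_extChartAt (by simpa [φ] using hmem)
      have hact := (hΦ.contMDiff_apply (ψ.symm u)).mdifferentiable (by simp) δz.proj
      have h1 := mfderiv_comp δz.proj hφd hact
      have h2 := mfderiv_eq_fderiv_writtenInExtChartAt (hφd.comp δz.proj hact)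
      have h3 := (HasFDerivAt.comp (g := F) (f := fun y => (u, y)) x
        ((contDiffAt_action_inCharts hΦ (p := (u, x)) hu.1 hx hu.2).differentiableAt
          (by simp)).hasFDerivAt (hasFDerivAt_prodMk_right (𝕜 := ℝ) u x)).fderiv
      refine (extChartAt_tangent_apply (q := tangentAction I Φ (ψ.symm u) δz) hmem).trans ?_
      refine Prod.ext ?_ ?_
      · exact congrArg (fun z => φ (Φ (ψ.symm u) z)) hφx.symm
      · refine (DFunLike.congr_fun h1 w).symm.trans ?_
        exact (DFunLike.congr_fun h2 w).trans (DFunLike.congr_fun h3 w)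
    rw [hev.fderiv_eq] at hm
    rw [hT.infinitesimalGenerator_eq]
    exact DFunLike.congr_fun hm ξ
  have hF2 : DifferentiableAt ℝ (fderiv ℝ F) (u₀, x) :=
    ((hFx x hx).fderiv_right (m := ∞) (by simp)).differentiableAt (by simp)
  have hinl : HasFDerivAt (fun u : EG => (u, x)) (ContinuousLinearMap.inl ℝ EG E) u₀ :=
    hasFDerivAt_prodMk_left u₀ x
  have hinr : HasFDerivAt (fun y : E => (u₀, y)) (ContinuousLinearMap.inr ℝ EG E) x :=
    hasFDerivAt_prodMk_right u₀ x
  have hD := (hF2.hasFDerivAt.comp x hinr).clm_apply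
    (hasFDerivAt_const (((ξ : EG), (0 : E)) : EG × E) x)
  refine ⟨_, hD.congr_of_eventuallyEq ?_, ?_⟩
  · filter_upwards [extChartAt_target_mem_nhds' hx] with y hy using hgen y hy
  · have hfst := ((hFx x hx).differentiableAt (by simp)).hasFDerivAt.comp u₀ hinl
    have hsnd := (hF2.hasFDerivAt.comp u₀ hinl).clm_apply
      (hasFDerivAt_const (((0 : EG), w) : EG × E) u₀)
    have hsymm := ((hFx x hx).isSymmSndFDerivAt minSmoothness_two_le_infty).eq (ξ, 0) (0, w)
    have hX : (infinitesimalGenerator I Φ ξ δz.proj : E) = fderiv ℝ F (u₀, x) (ξ, 0) := by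
      exact (mfderiv_extChartAt_vectorField_self (infinitesimalGenerator I Φ ξ) δz.proj).symm.trans
        (hgen x hx)
    have hder : ∀ e : EG, fderiv ℝ (fun u => ((F (u, x), fderiv ℝ F (u, x) (0, w)) : E × E)) u₀ e =
        (fderiv ℝ F (u₀, x) (e, 0), fderiv ℝ (fderiv ℝ F) (u₀, x) (e, 0) (0, w)) := by
      intro e
      refine (DFunLike.congr_fun (hfst.prodMk hsnd).fderiv e).trans ?_
      simp
    refine (hlift.trans (hder ξ)).trans (Prod.ext hX.symm (hsymm.trans ?_))
    simp

end TangentAction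

/-! ### Noether's theorem -/

section Conservation

variable {E : Type*} [NormedAddCommGroup E] [NormedSpace ℝ E]
  {H : Type*} [TopologicalSpace H] {I : ModelWithCorners ℝ E H}
  {M : Type*} [TopologicalSpace M] [ChartedSpace H M]
  {EG : Type*} [NormedAddCommGroup EG] [NormedSpace ℝ EG]
  {HG : Type*} [TopologicalSpace HG] {IG : ModelWithCorners ℝ EG HG}
  {G : Type*} [TopologicalSpace G] [ChartedSpace HG G] [Group G]
  {Φ : G → M → M} {J : M → LieDual IG G}

theorem IsMIntegralCurveOn.eq_of_mfderiv_eq_zero {X : (x : M) → TangentSpace I x} {γ : ℝ → M}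
    {s : Set ℝ} (hγ : IsMIntegralCurveOn γ X s) (hs : s.OrdConnected) {f : M → ℝ}
    (hf : MDifferentiable I 𝓘(ℝ, ℝ) f) (h0 : ∀ x, mfderiv I 𝓘(ℝ, ℝ) f x (X x) = (0 : ℝ))
    {t₁ t₂ : ℝ} (h₁ : t₁ ∈ s) (h₂ : t₂ ∈ s) : f (γ t₁) = f (γ t₂) := by
  have hder : ∀ t ∈ s, HasDerivWithinAt (f ∘ γ) 0 s t := by
    intro t ht
    have h := (hf (γ t)).hasMFDerivAt.comp_hasMFDerivWithinAt t (hγ t ht)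
    have h' : HasFDerivWithinAt (f ∘ γ) (0 : ℝ →L[ℝ] ℝ) s t := by
      refine hasMFDerivWithinAt_iff_hasFDerivWithinAt.1
        (h.congr_mfderiv (ContinuousLinearMap.ext_ring ?_))
      exact (congrArg (mfderiv I 𝓘(ℝ, ℝ) f (γ t)) (one_smul ℝ _)).trans (h0 _)
    simpa using h'.hasDerivWithinAt
  have h := hs.convex.norm_image_sub_le_of_norm_hasDerivWithin_le (C := 0) hder (by simp) h₁ h₂
  rw [zero_mul] at h
  exact (sub_eq_zero.1 (norm_le_zero_iff.1 h)).symm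

theorem IsMomentumMap.contMDiff_apply {Ω : DiffForm I M 2} (hJ : IsMomentumMap Ω Φ J) (ξ : EG) :
    ContMDiff I 𝓘(ℝ, ℝ) ∞ (fun x => J x ξ) :=
  (ContinuousLinearMap.apply ℝ ℝ ξ).contMDiff.comp hJ.smooth

theorem tangentLift_invariant {f : M → ℝ} (hf : ContMDiff I 𝓘(ℝ, ℝ) ∞ f)
    (hΦ : IsSmoothAction I IG Φ) (hinv : ∀ g x, f (Φ g x) = f x) (g : G) (δz : TangentBundle I M) :
    tangentLift f (tangentAction I Φ g δz) = tangentLift f δz := by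
  have h : f ∘ Φ g = f := funext (hinv g)
  have hc := mfderiv_comp δz.proj (hf.mdifferentiable (by simp) (Φ g δz.proj))
    ((hΦ.contMDiff_apply g).mdifferentiable (by simp) δz.proj)
  rw [h] at hc
  exact (DFunLike.congr_fun hc δz.2).symm

variable [CompleteSpace EG] [IG.Boundaryless] [LieGroup IG ∞ G] [T2Space G]

/-- Noether's theorem: `dJ_ξ(X) = Ω(ξ_M, X) = -dh(ξ_M) = 0` for the Hamiltonian vector field `X` of
an invariant function `h`. -/
theorem IsMomentumMap.eq_on_integralCurve {Ω : DiffForm I M 2} (hΦ : IsSmoothAction I IG Φ)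
    (hJ : IsMomentumMap Ω Φ J) {h : M → ℝ} (hh : ContMDiff I 𝓘(ℝ, ℝ) ∞ h)
    (hinv : ∀ g x, h (Φ g x) = h x) {X : (x : M) → TangentSpace I x}
    (hX : IsHamiltonianVectorField Ω h X) {s : Set ℝ} (hs : s.OrdConnected) {γ : ℝ → M}
    (hγ : IsMIntegralCurveOn γ X s) {t₁ t₂ : ℝ} (h₁ : t₁ ∈ s) (h₂ : t₂ ∈ s) :
    J (γ t₁) = J (γ t₂) := by
  refine ContinuousLinearMap.ext fun ξ => ?_
  refine hγ.eq_of_mfderiv_eq_zero (f := fun x => J x ξ) hs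
    ((hJ.contMDiff_apply ξ).mdifferentiable (by simp))
    (fun x => ?_) h₁ h₂
  rw [← hJ.hamiltonian ξ x (X x)]
  refine (ContinuousAlternatingMap.map_two_swap (V := E) (Ω x) _ _).trans ?_
  exact neg_eq_zero.2 ((hX x _).trans (hΦ.mfderiv_invariant_generator hh hinv ξ x))

/-- By Noether's theorem `J ∘ φ t = J` on the domain of the flow, which is open; the claim is the
derivative of this identity. -/
theorem IsMomentumMap.tangentLift_tangentMap_flow {Ω : DiffForm I M 2}
    (hΦ : IsSmoothAction I IG Φ) (hJ : IsMomentumMap Ω Φ J) {h : M → ℝ}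
    (hh : ContMDiff I 𝓘(ℝ, ℝ) ∞ h) (hinv : ∀ g x, h (Φ g x) = h x)
    {X : (x : M) → TangentSpace I x} (hX : IsHamiltonianVectorField Ω h X) {U : Set M} {s : Set ℝ}
    {φ : ℝ → M → M} (hφ : IsLocalFlow X U s φ) {t : ℝ} (ht : t ∈ s) {δz : TangentBundle I M}
    (hδz : δz.proj ∈ U) :
    SymplecticNoether.tangentLift J (tangentMap I I (φ t) δz) =
      SymplecticNoether.tangentLift J δz := by
  have hU := hφ.isOpen_space.mem_nhds hδz
  have hφt : MDifferentiableAt I I (φ t) δz.proj := by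
    have h1 := hφ.smooth.contMDiffAt
      ((hφ.isOpen_time.prod hφ.isOpen_space).mem_nhds (⟨ht, hδz⟩ : (t, δz.proj) ∈ s ×ˢ U))
    exact (h1.comp δz.proj (contMDiffAt_const.prodMk contMDiffAt_id)).mdifferentiableAt (by simp)
  have hev : J ∘ φ t =ᶠ[𝓝 δz.proj] J := by
    filter_upwards [hU] with z hz
    have h1 := hJ.eq_on_integralCurve hΦ hh hinv hX hφ.ordConnected_time (hφ.integralCurve z hz)
      ht hφ.zero_mem
    rw [hφ.map_zero z hz] at h1
    exact h1
  have hc := mfderiv_comp δz.proj (hJ.smooth.mdifferentiable (by simp) (φ t δz.proj)) hφt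
  exact (DFunLike.congr_fun hc δz.2).symm.trans
    (DFunLike.congr_fun (hev.mfderiv_eq (I := I) (I' := 𝓘(ℝ, LieDual IG G))) δz.2)

end Conservation

/-! ### The lifted momentum map -/

section TangentMomentum

variable {E : Type*} [NormedAddCommGroup E] [NormedSpace ℝ E]
  {H : Type*} [TopologicalSpace H] {I : ModelWithCorners ℝ E H}
  {M : Type*} [TopologicalSpace M] [ChartedSpace H M] [IsManifold I ∞ M]
  {EG : Type*} [NormedAddCommGroup EG] [NormedSpace ℝ EG] [CompleteSpace EG]
  {HG : Type*} [TopologicalSpace HG] {IG : ModelWithCorners ℝ EG HG} [IG.Boundaryless]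
  {G : Type*} [TopologicalSpace G] [ChartedSpace HG G] [Group G] [LieGroup IG ∞ G] [T2Space G]
  {Φ : G → M → M} {J : M → LieDual IG G}

/-- Since `Tτ` maps the generator of the tangent action to that of the action, the canonical
one-form evaluates on it to `Ω(ξ_M, δz) = dJ_ξ(δz)`. -/
theorem IsMomentumMap.tangentLift_apply {Ω : DiffForm I M 2}
    (hΦ : IsSmoothAction I IG Φ) (hJ : IsMomentumMap Ω Φ J) (ξ : GroupLieAlgebra IG G)
    (δz : TangentBundle I M) :
    SymplecticNoether.tangentLift J δz ξ = tangentOneForm Ω δz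
      ![infinitesimalGenerator I.tangent (tangentAction I Φ) ξ δz] := by
  rw [tangentOneForm_apply, ← tangentLift_clm_apply hJ.smooth ξ δz]
  refine (hJ.hamiltonian ξ δz.proj δz.2).symm.trans ?_
  refine congrArg (Ω δz.proj) ?_
  funext i
  fin_cases i
  · exact (mfderiv_proj_infinitesimalGenerator hΦ ξ δz).symm
  · rfl

variable [I.Boundaryless]

theorem IsMomentumMap.tangentLift {Ω : DiffForm I M 2} (hΩ : IsSymplecticForm Ω)
    (hΦ : IsSmoothAction I IG Φ) (hJ : IsMomentumMap Ω Φ J) :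
    IsMomentumMap (tangentSymplecticForm Ω) (tangentAction I Φ)
      (tangentLift (I := I) J : _ → LieDual IG G) where
  smooth := contMDiff_tangentLift hJ.smooth
  hamiltonian ξ δz v := by
    obtain ⟨D, hD, hgen⟩ := infinitesimalGenerator_tangentAction hΦ ξ δz
    have h := tangentSymplecticForm_lift hΩ.smooth hΩ.closed (hJ.contMDiff_apply ξ)
      (hJ.hamiltonian ξ) δz hD v
    have hfun : (fun δz => SymplecticNoether.tangentLift J δz ξ) =
        SymplecticNoether.tangentLift (I := I) (fun x => J x ξ) :=
      funext fun δz => (tangentLift_clm_apply hJ.smooth ξ δz).symm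
    rw [hfun, hgen]
    exact h

end TangentMomentum

end SymplecticNoether

theorem mainTheorem4
    {E : Type*} [NormedAddCommGroup E] [NormedSpace ℝ E] [FiniteDimensional ℝ E]
    {H : Type*} [TopologicalSpace H] (I : ModelWithCorners ℝ E H) [I.Boundaryless]
    {P : Type*} [TopologicalSpace P] [ChartedSpace H P] [IsManifold I ∞ P]
    {EG : Type*} [NormedAddCommGroup EG] [NormedSpace ℝ EG] [FiniteDimensional ℝ EG]
    {HG : Type*} [TopologicalSpace HG] (IG : ModelWithCorners ℝ EG HG) [IG.Boundaryless]
    {G : Type*} [TopologicalSpace G] [ChartedSpace HG G] [Group G] [LieGroup IG ∞ G] [T2Space G]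
    (Ω : DiffForm I P 2) (hΩ : IsSymplecticForm Ω)
    (Φ : G → P → P) (hΦ : IsSymplecticAction IG Ω Φ)
    (h : P → ℝ) (hh : ContMDiff I 𝓘(ℝ, ℝ) ∞ h) (hinv : ∀ (g : G) (z : P), h (Φ g z) = h z)
    (J : P → LieDual IG G) (hJ : IsMomentumMap Ω Φ J) :
    -- the tangent bundle is a symplectic manifold, and the induced action on it is symplectic
    IsSymplecticForm (tangentSymplecticForm Ω) ∧
    IsSymplecticAction IG (tangentSymplecticForm Ω)
      (tangentAction I Φ) ∧
    (∀ (g : G) (δz : TangentBundle I P),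
      (tangentOneForm Ω).pullback (tangentAction I Φ g) δz =
        tangentOneForm Ω δz) ∧
    -- the lift of `J` is a momentum map of the induced action, namely the canonical one
    IsMomentumMap (tangentSymplecticForm Ω)
      (tangentAction I Φ)
      (tangentLift (I := I) J : _ → LieDual IG G) ∧
    (∀ (ξ : GroupLieAlgebra IG G) (δz : TangentBundle I P),
      tangentLift J δz ξ =
        tangentOneForm Ω δz
          ![infinitesimalGenerator I.tangent
              (tangentAction I Φ) ξ δz]) ∧
    -- it is conserved along the solutions of the Hamiltonian system of the lift of `h`
    (∀ X : (δz : TangentBundle I P) → TangentSpace I.tangent δz,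
      IsHamiltonianVectorField (tangentSymplecticForm Ω)
        (tangentLift h) X →
      ∀ (s : Set ℝ), s.OrdConnected → ∀ γ : ℝ → TangentBundle I P,
        IsMIntegralCurveOn (I := I.tangent) γ X s →
        ∀ t₁ ∈ s, ∀ t₂ ∈ s,
          tangentLift J (γ t₁) = tangentLift J (γ t₂)) ∧
    -- and along the linearization of the flow of the Hamiltonian vector field of `h`
    (∀ X : (z : P) → TangentSpace I z, IsHamiltonianVectorField Ω h X →
      ∀ (U : Set P) (s : Set ℝ) (φ : ℝ → P → P), IsLocalFlow X U s φ →
        ∀ t ∈ s, ∀ δz : TangentBundle I P, δz.proj ∈ U →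
          tangentLift J (tangentMap I I (φ t) δz) =
            tangentLift J δz) := by
  have hT := hΦ.toIsSmoothAction.tangentAction
  have hJT := hJ.tangentLift hΩ hΦ.toIsSmoothAction
  exact ⟨isSymplecticForm_tangentSymplecticForm hΩ,
    { hT with symplectic := pullback_tangentSymplecticForm hΩ.smooth hΦ },
    pullback_tangentOneForm hΦ, hJT, hJ.tangentLift_apply hΦ.toIsSmoothAction,
    fun X hX s hs γ hγ t₁ h₁ t₂ h₂ =>
      hJT.eq_on_integralCurve hT (contMDiff_tangentLift hh)
        (tangentLift_invariant hh hΦ.toIsSmoothAction hinv) hX hs hγ h₁ h₂,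
    fun X hX U s φ hφ t ht δz hδz =>
      hJ.tangentLift_tangentMap_flow hΦ.toIsSmoothAction hh hinv hX hφ ht hδz⟩
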